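/- \textbf{Setting.} A $\Gamma$-set is a functor from the category $\Gamma^{\rm op}$ of finite pointed sets $k_+=\{*,1,\dots,k\}$ to pointed sets that preserves the zero object; an $\mathbb S$-algebra is a monoid, and a module over it a module, for the smash (Day convolution) product $\wedge$ of $\Gamma$-sets. For an abelian group $E$, $HE(k_+)=E^k$. Let $\overline{\operatorname{Spec}\mathbb Z}=\operatorname{Spec}\mathbb Z\cup\{\infty\}$, whose non-empty open sets are the complements of finite sets $F$ of points not containing the generic point. For an Arakelov divisor $D=(D_{\rm finite},a)$, with $D_{\rm finite}=\sum_p n_p\,p$ a divisor on $\operatorname{Spec}\mathbb Z$ and $a\in\mathbb R$, and for a non-empty open $U$, put $$E_D(U)=\{q\in\mathbb Q : q=0\ \text{or}\ \operatorname{ord}_p(q)+n_p\ge 0\ \text{for all primes } p\in U\},$$ and let $\mathcal O(D)(U)\subset H\mathbb Q$ be $HE_D(U)$ if $\infty\notin U$, and $$\mathcal O(D)(U)(k_+)=\Big\{\phi\in E_D(U)^k : \sum_i|\phi(i)|\le e^a\Big\}\quad\text{if }\infty\in U.$$ (All sections over $\emptyset$ are trivial.) The structure sheaf is $\mathcal O=\mathcal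 O(0)$, a sheaf of commutative $\mathbb S$-algebras with the product of $\mathbb Q$; every $\mathcal O(D)$ is a sheaf of $\mathcal O$-modules. Let $\mathcal O_\epsilon$ be the sheaf of $\mathcal O$-modules defined like $\mathcal O(0)$, with the condition $\sum_i|\phi(i)|<1$ if $\infty\in U$. For sheaves $M,N$ of $\mathcal O$-modules, $M\wedge_{\mathcal O}N$ is the sheaf associated to $U\mapsto M(U)\wedge_{\mathcal O(U)}N(U)$, where $M\wedge_AN$ is the coequalizer of $M\wedge A\wedge N\rightrightarrows M\wedge N$. The principal divisor of $q\in\mathbb Q^\times$ is $(q)=\big(\sum_p\operatorname{ord}_p(q)\,p,\,-\log|q|\big)$. \textbf{Proposition.} Let $D=(D_{\rm finite},a)$ and $D'=(D'_{\rm finite},a')$ be Arakelov divisors on $\overline{\operatorname{Spec}\mathbb Z}$. (i) Unless $e^a$ and $e^{a'}$ are both irrational while $e^ae^{a'}$ is rational, the morphism $\mathcal O(D)\wedge_{\mathcal O}\mathcal O(D')\to\mathcal O(D+D')$ induced by the product of $\mathbb Q$ is an isomorphism of sheaves of $\mathcal O$-modules. In the exceptional case $\mathcal O(D)\wedge_{\mathcal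 O}\mathcal O(D')$ is not isomorphic to $\mathcal O(D+D')$ as a sheaf of $\mathcal O$-modules, and there are isomorphisms of sheaves of $\mathcal O$-modules $$\mathcal O(D)\wedge_{\mathcal O}\mathcal O(D')\simeq\mathcal O_\epsilon\wedge_{\mathcal O}\mathcal O(D+D')\simeq\mathcal O(D+D')\wedge_{\mathcal O}\mathcal O_\epsilon .$$ (ii) $D'-D=(q)$ for some $q\in\mathbb Q^\times$ if and only if $\mathcal O(D)$ and $\mathcal O(D')$ are isomorphic as sheaves of $\mathcal O$-modules. -/

import Mathlib

open CategoryTheory TopologicalSpace Opposite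

namespace GammaArith

/-! ## The category of finite pointed sets `k₊` -/

/-- Objects of `Γᵒᵖ`: the object `⟨k⟩` is the finite pointed set `k₊ = {*, 1, …, k}`. -/
structure GammaOp where
  /-- the number of points different from the base point -/
  card : ℕ

/-- The underlying set of `k₊`; the base point is `none`. -/
abbrev GammaOp.Pt (k : GammaOp) : Type := Option (Fin k.card)

/-- Maps of finite pointed sets. -/
@[ext]
structure PMap (m n : GammaOp) where
  /-- the underlying map -/
  toFun : m.Pt → n.Pt
  map_none : toFun none = none

instance : Category GammaOp where
  Hom := PMap
  id _ := ⟨fun x => x, rfl⟩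
  comp f g := ⟨fun x => g.toFun (f.toFun x), by rw [f.map_none, g.map_none]⟩

@[simp] theorem PMap.id_toFun (m : GammaOp) (x : m.Pt) : PMap.toFun (𝟙 m) x = x := rfl

@[simp] theorem PMap.comp_toFun {m n k : GammaOp} (f : m ⟶ n) (g : n ⟶ k) (x : m.Pt) :
    PMap.toFun (f ≫ g) x = PMap.toFun g (PMap.toFun f x) := rfl

/-- Pointed maps `m₊ ∧ n₊ → k₊`, given as maps on `m₊ × n₊` that send
`m₊ × {*} ∪ {*} × n₊` to the base point. -/
@[ext]
structure SmashMap (m n k : GammaOp) where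
  /-- the underlying map -/
  toFun : m.Pt → n.Pt → k.Pt
  left_none : ∀ y, toFun none y = none
  right_none : ∀ x, toFun x none = none

namespace SmashMap

/-- The composite `m₊ ∧ n₊ → m'₊ ∧ n'₊ → k₊`. -/
def pre {m n m' n' k : GammaOp} (v : SmashMap m' n' k) (f : m ⟶ m') (g : n ⟶ n') :
    SmashMap m n k where
  toFun x y := v.toFun (PMap.toFun f x) (PMap.toFun g y)
  left_none y := by rw [PMap.map_none, v.left_none]
  right_none x := by rw [PMap.map_none, v.right_none]

/-- The composite `m₊ ∧ n₊ → k₊ → k'₊`. -/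
def post {m n k k' : GammaOp} (v : SmashMap m n k) (h : k ⟶ k') : SmashMap m n k' where
  toFun x y := PMap.toFun h (v.toFun x y)
  left_none y := by rw [v.left_none, PMap.map_none]
  right_none x := by rw [v.right_none, PMap.map_none]

/-- The composite of `v` with the exchange `n₊ ∧ m₊ → m₊ ∧ n₊`. -/
def swap {m n k : GammaOp} (v : SmashMap m n k) : SmashMap n m k where
  toFun y x := v.toFun x y
  left_none y := v.right_none y
  right_none x := v.left_none x

/-- The pointed map `v (x, -)`. -/
def slice {m n k : GammaOp} (v : SmashMap m n k) (x : m.Pt) : n ⟶ k :=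
  ⟨fun y => v.toFun x y, v.right_none x⟩

/-- The identification `m₊ ∧ n₊ ≃ (m n)₊`. -/
def univ (m n : GammaOp) : SmashMap m n ⟨m.card * n.card⟩ where
  toFun x y := x.bind fun i => y.map fun j => finProdFinEquiv (i, j)
  left_none y := rfl
  right_none x := by cases x <;> rfl

/-- The map `(m n)₊ → k₊` corresponding to a map `m₊ ∧ n₊ → k₊`. -/
def lift {m n k : GammaOp} (v : SmashMap m n k) : (⟨m.card * n.card⟩ : GammaOp) ⟶ k :=
  ⟨fun z => z.bind fun i =>
    v.toFun (some (finProdFinEquiv.symm i).1) (some (finProdFinEquiv.symm i).2), rfl⟩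

theorem some_eq_univ {m n : GammaOp} (z : Fin (m.card * n.card)) :
    (some z : GammaOp.Pt ⟨m.card * n.card⟩) = (univ m n).toFun
      (some (finProdFinEquiv.symm z).1) (some (finProdFinEquiv.symm z).2) := by
  simp [univ, -finProdFinEquiv_symm_apply]

theorem lift_univ {m n k : GammaOp} (v : SmashMap m n k) (x : m.Pt) (y : n.Pt) :
    PMap.toFun v.lift ((univ m n).toFun x y) = v.toFun x y := by
  cases x with
  | none => simp [univ, lift, v.left_none]
  | some i => cases y with
    | none => simp [univ, lift, v.right_none]
    | some j => simp [univ, lift, -finProdFinEquiv_symm_apply]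

theorem univ_post_lift {m n k : GammaOp} (v : SmashMap m n k) : (univ m n).post v.lift = v := by
  ext1; funext x y; exact lift_univ v x y

end SmashMap

/-- For a map `w : l₊ ∧ k₊ → k'₊` and a map `v : m₊ ∧ n₊ → k₊`, the map
`(l₊ ∧ m₊) ∧ n₊ ≃ l₊ ∧ (m₊ ∧ n₊) → k'₊`, `(c ∧ x) ∧ y ↦ w (c, v (x, y))`. -/
def SmashMap.assoc {l m n k k' : GammaOp} (w : SmashMap l k k') (v : SmashMap m n k) :
    SmashMap ⟨l.card * m.card⟩ n k' where
  toFun z y := z.bind fun i => w.toFun (some (finProdFinEquiv.symm i).1)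
    (v.toFun (some (finProdFinEquiv.symm i).2) y)
  left_none y := rfl
  right_none x := by cases x <;> simp [v.right_none, w.right_none]

theorem SmashMap.assoc_univ {l m n k k' : GammaOp} (w : SmashMap l k k') (v : SmashMap m n k)
    (c : l.Pt) (x : m.Pt) (y : n.Pt) :
    (w.assoc v).toFun ((univ l m).toFun c x) y = w.toFun c (v.toFun x y) := by
  cases c with
  | none => simp [univ, assoc, w.left_none]
  | some i => cases x with
    | none => simp [univ, assoc, v.left_none, w.right_none]
    | some j => simp [univ, assoc, -finProdFinEquiv_symm_apply]

/-! ## Γ-sets, `𝕊`-algebras and modules -/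

/-- A Γ-set: a functor from `Γᵒᵖ` to pointed sets that preserves the zero object. -/
structure GammaSet extends GammaOp ⥤ Pointed.{0} where
  subsingleton_zero : Subsingleton (obj ⟨0⟩)

/-- The map `M(f)` on elements. -/
abbrev GammaSet.mp (M : GammaSet) {m n : GammaOp} (f : m ⟶ n) (x : M.obj m) : M.obj n :=
  Pointed.Hom.toFun (M.map f) x

theorem GammaSet.mp_id (M : GammaSet) {m : GammaOp} (x : M.obj m) : M.mp (𝟙 m) x = x := by
  unfold GammaSet.mp; rw [M.map_id]; rfl

theorem GammaSet.mp_comp (M : GammaSet) {m n k : GammaOp} (f : m ⟶ n) (g : n ⟶ k) (x : M.obj m) :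
    M.mp (f ≫ g) x = M.mp g (M.mp f x) := by
  unfold GammaSet.mp; rw [M.map_comp]; rfl

theorem GammaSet.mp_point (M : GammaSet) {m n : GammaOp} (f : m ⟶ n) :
    M.mp f (M.obj m).point = (M.obj n).point := Pointed.Hom.map_point _

/-- A morphism of Γ-sets (a natural transformation) on elements. -/
abbrev evalAt {F G : GammaOp ⥤ Pointed.{0}} (φ : F ⟶ G) {n : GammaOp} (x : F.obj n) : G.obj n :=
  Pointed.Hom.toFun (φ.app n) x

theorem evalAt_map {F G : GammaOp ⥤ Pointed.{0}} (φ : F ⟶ G) {m n : GammaOp} (f : m ⟶ n)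
    (x : F.obj m) :
    evalAt φ (Pointed.Hom.toFun (F.map f) x) = Pointed.Hom.toFun (G.map f) (evalAt φ x) :=
  congrFun (congrArg Pointed.Hom.toFun (φ.naturality f)) x

/-- The Γ-set `𝕊`: the inclusion of `Γᵒᵖ` into pointed sets. -/
def sphere : GammaSet where
  obj n := Pointed.of (none : n.Pt)
  map f := ⟨f.toFun, f.map_none⟩
  subsingleton_zero := ⟨fun a b => by
    rcases a with _ | a
    · rcases b with _ | b
      · rfl
      · exact b.elim0
    · exact a.elim0⟩

/-- A commutative `𝕊`-algebra. The multiplication `A ∧ A → A` is given, through the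
universal property of the colimit defining the smash product of Γ-sets, by maps
`A(m₊) × A(n₊) → A(k₊)` for all pointed maps `v : m₊ ∧ n₊ → k₊`, natural in `m₊, n₊, k₊`. -/
structure CommSAlg extends GammaSet where
  /-- the unit `𝕊 → A` -/
  one : sphere.toFunctor ⟶ toFunctor
  /-- the multiplication `A ∧ A → A` -/
  mul : ∀ {m n k : GammaOp}, obj m → obj n → SmashMap m n k → obj k
  mul_map : ∀ {m n m' n' k : GammaOp} (f : m ⟶ m') (g : n ⟶ n') (v : SmashMap m' n' k)
    (a : obj m) (b : obj n),
    mul (toGammaSet.mp f a) (toGammaSet.mp g b) v = mul a b (v.pre f g)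
  map_mul : ∀ {m n k k' : GammaOp} (v : SmashMap m n k) (h : k ⟶ k') (a : obj m) (b : obj n),
    toGammaSet.mp h (mul a b v) = mul a b (v.post h)
  one_mul : ∀ {m n k : GammaOp} (v : SmashMap m n k) (c : m.Pt) (b : obj n),
    mul (evalAt one c) b v = toGammaSet.mp (v.slice c) b
  mul_assoc : ∀ {l m n p p' q : GammaOp} (v : SmashMap l m p) (w : SmashMap p n q)
    (v' : SmashMap m n p') (w' : SmashMap l p' q)
    (_ : ∀ c x y, w.toFun (v.toFun c x) y = w'.toFun c (v'.toFun x y))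
    (a : obj l) (b : obj m) (c : obj n), mul (mul a b v) c w = mul a (mul b c v') w'
  mul_comm : ∀ {m n k : GammaOp} (v : SmashMap m n k) (a : obj m) (b : obj n),
    mul a b v = mul b a v.swap

/-- Morphisms of `𝕊`-algebras. -/
@[ext]
structure CommSAlg.Hom (A B : CommSAlg) where
  /-- the underlying morphism of Γ-sets -/
  nat : A.toFunctor ⟶ B.toFunctor
  map_one : A.one ≫ nat = B.one
  map_mul : ∀ {m n k : GammaOp} (v : SmashMap m n k) (a : A.obj m) (b : A.obj n),
    evalAt nat (A.mul a b v) = B.mul (evalAt nat a) (evalAt nat b) v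

instance : Category CommSAlg where
  Hom := CommSAlg.Hom
  id A := ⟨𝟙 _, Category.comp_id _, fun _ _ _ => rfl⟩
  comp f g := ⟨f.nat ≫ g.nat, by rw [← Category.assoc, f.map_one, g.map_one], fun v a b => by
    have h1 := f.map_mul v a b
    have h2 := g.map_mul v (evalAt f.nat a) (evalAt f.nat b)
    rw [← h1] at h2
    exact h2⟩

/-- A module over a commutative `𝕊`-algebra `A`: a Γ-set `M` with an action `A ∧ M → M`. -/
structure SMod (A : CommSAlg) extends GammaSet where
  /-- the action `A ∧ M → M` -/
  act : ∀ {m n k : GammaOp}, A.obj m → obj n → SmashMap m n k → obj k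
  act_map : ∀ {m n m' n' k : GammaOp} (f : m ⟶ m') (g : n ⟶ n') (v : SmashMap m' n' k)
    (a : A.obj m) (x : obj n),
    act (A.mp f a) (toGammaSet.mp g x) v = act a x (v.pre f g)
  map_act : ∀ {m n k k' : GammaOp} (v : SmashMap m n k) (h : k ⟶ k') (a : A.obj m) (x : obj n),
    toGammaSet.mp h (act a x v) = act a x (v.post h)
  one_act : ∀ {m n k : GammaOp} (v : SmashMap m n k) (c : m.Pt) (x : obj n),
    act (evalAt A.one c) x v = toGammaSet.mp (v.slice c) x
  mul_act : ∀ {l m n p p' q : GammaOp} (v : SmashMap l m p) (w : SmashMap p n q)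
    (v' : SmashMap m n p') (w' : SmashMap l p' q)
    (_ : ∀ c x y, w.toFun (v.toFun c x) y = w'.toFun c (v'.toFun x y))
    (a : A.obj l) (b : A.obj m) (x : obj n), act (A.mul a b v) x w = act a (act b x v') w'

namespace SMod

variable {A : CommSAlg}

theorem act_point (M : SMod A) {m n k : GammaOp} (a : A.obj m) (v : SmashMap m n k) :
    M.act a (M.obj n).point v = (M.obj k).point := by
  let z : (⟨0⟩ : GammaOp) ⟶ n := ⟨fun _ => none, rfl⟩
  let t : (⟨0⟩ : GammaOp) ⟶ k := ⟨fun _ => none, rfl⟩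
  let v0 : SmashMap m ⟨0⟩ ⟨0⟩ := ⟨fun _ _ => none, fun _ => rfl, fun _ => rfl⟩
  have h1 : M.act (A.mp (𝟙 m) a) (M.mp z (M.obj ⟨0⟩).point) v = _ := M.act_map (𝟙 m) z v a _
  rw [A.mp_id, M.mp_point] at h1
  have h2 : v.pre (𝟙 m) z = v0.post t := by
    ext1; funext x y; exact v.right_none x
  have h3 : M.act a (M.obj ⟨0⟩).point v0 = (M.obj ⟨0⟩).point := M.subsingleton_zero.elim _ _
  rw [h1, h2, ← M.map_act, h3, M.mp_point]

theorem act_eq_mp (M : SMod A) {m n k : GammaOp} (a : A.obj m) (x : M.obj n) (v : SmashMap m n k) :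
    M.act a x v = M.mp v.lift (M.act a x (SmashMap.univ m n)) := by
  rw [M.map_act, SmashMap.univ_post_lift]

end SMod

/-! ## The smash product over an `𝕊`-algebra -/

/-- Representatives `(m₊, n₊, x, y, v)` of elements of `(M ∧ N)(k₊)`. -/
structure SmashPre {A : CommSAlg} (M N : SMod A) (k : GammaOp) where
  {m : GammaOp}
  {n : GammaOp}
  x : M.obj m
  y : N.obj n
  v : SmashMap m n k

/-- The relations defining `(M ∧_A N)(k₊)`. The first two relations define the colimit
`(M ∧ N)(k₊) = colim M(m₊) ∧ N(n₊)` over all `v : m₊ ∧ n₊ → k₊`;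
the third one is the passage to the coequalizer of the two maps from `M ∧ A ∧ N`, that is,
`(x a) ∧ y ~ x ∧ (a y)`, the right action of the commutative algebra `A` being `x a = a x`. -/
inductive SmashRel {A : CommSAlg} (M N : SMod A) (k : GammaOp) :
    SmashPre M N k → SmashPre M N k → Prop
  | map {m n m' n' : GammaOp} (f : m ⟶ m') (g : n ⟶ n') (x : M.obj m) (y : N.obj n)
      (v : SmashMap m' n' k) :
      SmashRel M N k ⟨x, y, v.pre f g⟩ ⟨M.mp f x, N.mp g y, v⟩
  | point {m n m' n' : GammaOp} (x : M.obj m) (y : N.obj n) (v : SmashMap m n k)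
      (x' : M.obj m') (y' : N.obj n') (v' : SmashMap m' n' k)
      (h : x = (M.obj m).point ∨ y = (N.obj n).point)
      (h' : x' = (M.obj m').point ∨ y' = (N.obj n').point) :
      SmashRel M N k ⟨x, y, v⟩ ⟨x', y', v'⟩
  | balance {l m n p q : GammaOp} (a : A.obj l) (x : M.obj m) (y : N.obj n)
      (r : SmashMap l m p) (w : SmashMap p n k) (s : SmashMap l n q) (w' : SmashMap m q k)
      (h : ∀ c i j, w.toFun (r.toFun c i) j = w'.toFun i (s.toFun c j)) :
      SmashRel M N k ⟨M.act a x r, y, w⟩ ⟨x, N.act a y s, w'⟩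

/-- The set `(M ∧_A N)(k₊)`. -/
def SmashObj {A : CommSAlg} (M N : SMod A) (k : GammaOp) : Type := Quot (SmashRel M N k)

section Smash

variable {A : CommSAlg} (M N : SMod A)

/-- The class of `(m₊, n₊, x, y, v)` in `(M ∧_A N)(k₊)`. -/
def smashMk {M N : SMod A} {m n k : GammaOp} (x : M.obj m) (y : N.obj n) (v : SmashMap m n k) :
    SmashObj M N k := Quot.mk _ ⟨x, y, v⟩

/-- The base point of `(M ∧_A N)(k₊)`. -/
def smashPoint (k : GammaOp) : SmashObj M N k :=
  smashMk (M.obj ⟨0⟩).point (N.obj ⟨0⟩).point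
    (⟨fun _ _ => none, fun _ => rfl, fun _ => rfl⟩ : SmashMap ⟨0⟩ ⟨0⟩ k)

variable {M N}

theorem smashMk_map {m n m' n' k : GammaOp} (f : m ⟶ m') (g : n ⟶ n') (x : M.obj m) (y : N.obj n)
    (v : SmashMap m' n' k) :
    smashMk (M.mp f x) (N.mp g y) v = smashMk x y (v.pre f g) :=
  (Quot.sound (SmashRel.map f g x y v)).symm

theorem smashMk_point {m n k : GammaOp} (x : M.obj m) (y : N.obj n) (v : SmashMap m n k)
    (h : x = (M.obj m).point ∨ y = (N.obj n).point) :
    smashMk x y v = smashPoint M N k :=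
  Quot.sound (SmashRel.point _ _ _ _ _ _ h (Or.inl rfl))

theorem smashMk_act {l m p p' n k : GammaOp} (a : A.obj l) (x : M.obj m) (y : N.obj n)
    (r : SmashMap l m p) (w : SmashMap p n k) (r' : SmashMap l m p') (w' : SmashMap p' n k)
    (h : ∀ c i j, w.toFun (r.toFun c i) j = w'.toFun (r'.toFun c i) j) :
    smashMk (M.act a x r) y w = smashMk (M.act a x r') y w' := by
  rw [M.act_eq_mp a x r, M.act_eq_mp a x r', ← N.mp_id y, smashMk_map, smashMk_map]
  congr 1
  ext1; funext z j
  rcases z with _ | z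
  · exact ((w.pre r.lift (𝟙 n)).left_none j).trans ((w'.pre r'.lift (𝟙 n)).left_none j).symm
  · simp only [SmashMap.pre]
    rw [SmashMap.some_eq_univ z, SmashMap.lift_univ, SmashMap.lift_univ]
    exact h _ _ _

/-- Functoriality of `M ∧_A N` in `k₊`. -/
def smashMap {k k' : GammaOp} (h : k ⟶ k') : SmashObj M N k → SmashObj M N k' :=
  Quot.lift (fun t => smashMk t.x t.y (t.v.post h)) (by
    rintro _ _ (⟨f, g, x, y, v⟩ | ⟨x, y, v, x', y', v', h1, h2⟩ | ⟨a, x, y, r, w, s, w', e⟩)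
    · exact (smashMk_map f g x y (v.post h)).symm
    · exact (smashMk_point _ _ _ h1).trans (smashMk_point _ _ _ h2).symm
    · exact Quot.sound (SmashRel.balance a x y r _ s _ fun c i j =>
        congrArg (PMap.toFun h) (e c i j)))

/-- The action of `A` on `M ∧_A N` through `M`. -/
def smashAct {l k k' : GammaOp} (a : A.obj l) (t : SmashObj M N k) (w : SmashMap l k k') :
    SmashObj M N k' :=
  Quot.lift (fun t => smashMk (M.act a t.x (SmashMap.univ l t.m)) t.y (w.assoc t.v)) (by
    rintro _ _ (⟨f, g, x, y, v⟩ | ⟨x, y, v, x', y', v', h1, h2⟩ | ⟨b, x, y, r, u, s, u', e⟩)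
    · dsimp only
      have h1 := M.act_map (𝟙 l) f (SmashMap.univ l _) a x
      rw [A.mp_id] at h1
      rw [h1, ← M.mp_id (M.act a x ((SmashMap.univ l _).pre (𝟙 l) f)), smashMk_map]
      apply smashMk_act
      intro c i j
      simp only [SmashMap.pre, PMap.id_toFun, SmashMap.assoc_univ]
    · rw [smashMk_point, smashMk_point]
      · exact h2.imp (fun h => by dsimp only; rw [h, M.act_point]) id
      · exact h1.imp (fun h => by dsimp only; rw [h, M.act_point]) id
    · dsimp only
      rename_i lb m n p q
      -- `a (b x) = (b a) x = b (a x)`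
      let uv := SmashMap.univ l p
      let r' : SmashMap lb ⟨l.card * m.card⟩ ⟨l.card * p.card⟩ :=
        ⟨fun d z => z.bind fun i => uv.toFun (some (finProdFinEquiv.symm i).1)
          (r.toFun d (some (finProdFinEquiv.symm i).2)), fun d => by
            cases d <;> simp [r.left_none, uv.right_none], fun d => rfl⟩
      have hr' : ∀ d c i, r'.toFun d ((SmashMap.univ l m).toFun c i) =
          uv.toFun c (r.toFun d i) := by
        intro d c i
        cases c with
        | none => simp [SmashMap.univ, r', uv]
        | some c => cases i with
          | none => simp [SmashMap.univ, r', uv, r.right_none]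
          | some i => simp [SmashMap.univ, r', -finProdFinEquiv_symm_apply]
      let V := SmashMap.univ l lb
      let W : SmashMap ⟨l.card * lb.card⟩ m ⟨l.card * p.card⟩ := uv.assoc r
      have e1 : M.act (A.mul a b V) x W = M.act a (M.act b x r) uv :=
        M.mul_act V W r uv (fun c d i => SmashMap.assoc_univ uv r c d i) a b x
      have e2 : M.act (A.mul b a V.swap) x W = M.act b (M.act a x (SmashMap.univ l m)) r' :=
        M.mul_act V.swap W (SmashMap.univ l m) r'
          (fun d c i => (SmashMap.assoc_univ uv r c d i).trans (hr' d c i).symm) b a x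
      rw [← e1, A.mul_comm, e2]
      apply Quot.sound
      apply SmashRel.balance
      intro d z j
      rcases z with _ | z
      · rw [r'.right_none, SmashMap.left_none, SmashMap.left_none]
      · rw [SmashMap.some_eq_univ z, hr', SmashMap.assoc_univ, SmashMap.assoc_univ, e]) t

theorem smashAct_mk {l m n p k k' : GammaOp} (a : A.obj l) (x : M.obj m) (y : N.obj n)
    (v : SmashMap m n k) (w : SmashMap l k k') (r : SmashMap l m p) (u : SmashMap p n k')
    (h : ∀ c i j, u.toFun (r.toFun c i) j = w.toFun c (v.toFun i j)) :
    smashAct a (smashMk x y v) w = smashMk (M.act a x r) y u :=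
  smashMk_act _ _ _ _ _ _ _ fun c i j => (SmashMap.assoc_univ w v c i j).trans (h c i j).symm

variable (M N)

/-- The Γ-set `M ∧_A N`. -/
def smashGamma : GammaSet where
  obj k := Pointed.of (smashPoint M N k)
  map h := ⟨smashMap h, smashMk_point _ _ _ (Or.inl rfl)⟩
  map_id k := by
    apply Pointed.Hom.ext; funext t
    obtain ⟨x, y, v⟩ := t
    rfl
  map_comp f g := by
    apply Pointed.Hom.ext; funext t
    obtain ⟨x, y, v⟩ := t
    rfl
  subsingleton_zero := ⟨by
    suffices H : ∀ t : SmashObj M N ⟨0⟩, t = smashPoint M N ⟨0⟩ from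
      fun s t => (H s).trans (H t).symm
    rintro ⟨x, y, v⟩
    rename_i m n
    let z : ∀ m : GammaOp, m ⟶ ⟨0⟩ := fun m => ⟨fun _ => none, rfl⟩
    let v0 : SmashMap ⟨0⟩ ⟨0⟩ ⟨0⟩ := ⟨fun _ _ => none, fun _ => rfl, fun _ => rfl⟩
    have hv : v = v0.pre (z m) (z n) := by
      ext1; funext i j
      rcases h : v.toFun i j with _ | c
      · rfl
      · exact c.elim0
    change smashMk x y v = _
    rw [hv, ← smashMk_map]
    exact smashMk_point _ _ _ (Or.inl (M.subsingleton_zero.elim _ _))⟩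

/-- The smash product `M ∧_A N`, as an `A`-module. -/
def smash : SMod A where
  toGammaSet := smashGamma M N
  act a t v := smashAct a t v
  act_map f g v a t := by
    obtain ⟨x, y, u⟩ := t
    change smashAct (A.mp f a) (smashMk x y (u.post g)) v = smashAct a (smashMk x y u) (v.pre f g)
    have h := M.act_map f (𝟙 _) (SmashMap.univ _ _) a x
    rw [M.mp_id] at h
    rw [smashAct_mk _ _ _ _ _ _ _ (SmashMap.assoc_univ _ _), h]
    symm
    apply smashAct_mk
    intro c i j
    simp only [SmashMap.pre, PMap.id_toFun, SmashMap.assoc_univ]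
    rfl
  map_act v h a t := by
    obtain ⟨x, y, u⟩ := t
    change smashMk _ _ _ = smashAct a (smashMk x y u) _
    symm
    apply smashAct_mk
    intro c i j
    exact congrArg (PMap.toFun h) (SmashMap.assoc_univ v u c i j)
  one_act v c t := by
    obtain ⟨x, y, u⟩ := t
    rename_i m n
    change smashAct _ (smashMk x y u) v = smashMk x y (u.post (v.slice c))
    rw [smashAct_mk _ _ _ _ _ _ _ (SmashMap.assoc_univ _ _), M.one_act]
    rw [← N.mp_id y, smashMk_map, N.mp_id]
    congr 1
    ext1; funext i j
    exact SmashMap.assoc_univ v u c i j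
  mul_act v w v' w' h a b t := by
    obtain ⟨x, y, u⟩ := t
    change smashAct _ (smashMk x y u) w = smashAct a (smashAct b (smashMk x y u) v') w'
    rw [smashAct_mk b x y u v' _ _ (SmashMap.assoc_univ _ _),
      smashAct_mk a _ y _ w' _ _ (SmashMap.assoc_univ _ _),
      smashAct_mk _ x y u w _ _ (SmashMap.assoc_univ _ _)]
    rename_i m' n'
    have e1 : A.mul a b v = A.mp v.lift (A.mul a b (SmashMap.univ _ _)) := by
      rw [A.map_mul, SmashMap.univ_post_lift]
    have e2 := M.act_map v.lift (𝟙 m') (SmashMap.univ _ m') (A.mul a b (SmashMap.univ _ _)) x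
    rw [M.mp_id] at e2
    rw [e1, e2, ← M.mul_act (SmashMap.univ _ _)
      (SmashMap.assoc (SmashMap.univ _ _) (SmashMap.univ _ _))
      (SmashMap.univ _ m') (SmashMap.univ _ _) (SmashMap.assoc_univ _ _)]
    apply smashMk_act
    intro z i j
    rcases z with _ | z
    · rw [SmashMap.left_none, SmashMap.left_none, SmashMap.left_none, SmashMap.left_none]
    · rename_i l0 m0 p0 q0 p1 q1
      rw [SmashMap.some_eq_univ z, SmashMap.assoc_univ, SmashMap.assoc_univ, SmashMap.assoc_univ]
      simp only [SmashMap.pre, PMap.id_toFun, SmashMap.lift_univ, SmashMap.assoc_univ]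
      exact h _ _ _

end Smash

/-! ## Sheaves of modules over a presheaf of `𝕊`-algebras -/

section Sheaves

variable {X : TopCat.{0}} (O : TopCat.Presheaf CommSAlg X)

/-- Restriction of sections of `O`. -/
abbrev resAlg {U V : Opens X} (h : U ≤ V) {n : GammaOp} (a : (O.obj (op V)).obj n) :
    (O.obj (op U)).obj n := evalAt (CommSAlg.Hom.nat (O.map (homOfLE h).op)) a

theorem resAlg_res {U V W : Opens X} (h : U ≤ V) (h' : V ≤ W) {n : GammaOp}
    (a : (O.obj (op W)).obj n) : resAlg O h (resAlg O h' a) = resAlg O (h.trans h') a := by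
  have e : O.map (homOfLE (h.trans h')).op = O.map (homOfLE h').op ≫ O.map (homOfLE h).op := by
    rw [← O.map_comp]; rfl
  unfold resAlg
  rw [e]
  rfl

theorem resAlg_mul {U V : Opens X} (h : U ≤ V) {m n k : GammaOp} (a : (O.obj (op V)).obj m)
    (b : (O.obj (op V)).obj n) (v : SmashMap m n k) :
    resAlg O h ((O.obj (op V)).mul a b v) = (O.obj (op U)).mul (resAlg O h a) (resAlg O h b) v :=
  CommSAlg.Hom.map_mul _ v a b

theorem resAlg_one {U V : Opens X} (h : U ≤ V) {n : GammaOp} (c : n.Pt) :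
    resAlg O h (evalAt (O.obj (op V)).one c) = evalAt (O.obj (op U)).one c := by
  rw [← CommSAlg.Hom.map_one (O.map (homOfLE h).op)]
  rfl

/-- A presheaf of `O`-modules. -/
structure PresheafOfSMod where
  /-- the sections over `U` -/
  obj : ∀ U : Opens X, SMod (O.obj (op U))
  /-- the restriction maps -/
  res : ∀ {U V : Opens X}, U ≤ V → ((obj V).toFunctor ⟶ (obj U).toFunctor)
  res_self : ∀ (U : Opens X), res (le_refl U) = 𝟙 _
  res_res : ∀ {U V W : Opens X} (h : U ≤ V) (h' : V ≤ W), res h' ≫ res h = res (h.trans h')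
  res_act : ∀ {U V : Opens X} (h : U ≤ V) {m n k : GammaOp} (v : SmashMap m n k)
    (a : (O.obj (op V)).obj m) (x : (obj V).obj n),
    evalAt (res h) ((obj V).act a x v) = (obj U).act (resAlg O h a) (evalAt (res h) x) v

variable {O}

/-- Morphisms of presheaves of `O`-modules. -/
@[ext]
structure PresheafOfSMod.Hom (M N : PresheafOfSMod O) where
  /-- the map on sections over `U` -/
  app : ∀ U : Opens X, (M.obj U).toFunctor ⟶ (N.obj U).toFunctor
  app_res : ∀ {U V : Opens X} (h : U ≤ V), app V ≫ N.res h = M.res h ≫ app U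
  app_act : ∀ (U : Opens X) {m n k : GammaOp} (v : SmashMap m n k)
    (a : (O.obj (op U)).obj m) (x : (M.obj U).obj n),
    evalAt (app U) ((M.obj U).act a x v) = (N.obj U).act a (evalAt (app U) x) v

instance : Category (PresheafOfSMod O) where
  Hom := PresheafOfSMod.Hom
  id M := ⟨fun U => 𝟙 _, fun h => by rw [Category.id_comp, Category.comp_id],
    fun _ _ _ _ _ _ _ => rfl⟩
  comp f g := ⟨fun U => f.app U ≫ g.app U, fun h => by
      rw [Category.assoc, g.app_res, ← Category.assoc, f.app_res, Category.assoc],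
    fun U _ _ _ v a x => by
      have h1 := f.app_act U v a x
      have h2 := g.app_act U v a (evalAt (f.app U) x)
      rw [← h1] at h2
      exact h2⟩

/-- The sheaf condition: for all `k`, compatible families of sections in `M(U i)(k₊)`
glue uniquely. -/
def PresheafOfSMod.IsSheaf (M : PresheafOfSMod O) : Prop :=
  ∀ (ι : Type) (U : ι → Opens X) (n : GammaOp) (s : ∀ i, (M.obj (U i)).obj n),
    (∀ i j, evalAt (M.res (inf_le_left : U i ⊓ U j ≤ U i)) (s i) =
      evalAt (M.res (inf_le_right : U i ⊓ U j ≤ U j)) (s j)) →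
    ∃! t : (M.obj (⨆ i, U i)).obj n, ∀ i, evalAt (M.res (le_iSup U i)) t = s i

variable (O) in
/-- The category of sheaves of `O`-modules, a full subcategory of the presheaves. -/
abbrev SheafOfSMod : Type 1 :=
  ObjectProperty.FullSubcategory (PresheafOfSMod.IsSheaf (O := O))

namespace PresheafOfSMod

variable (M N : PresheafOfSMod O)

theorem res_res_apply {U V W : Opens X} (h : U ≤ V) (h' : V ≤ W) {n : GammaOp}
    (x : (M.obj W).obj n) :
    evalAt (M.res h) (evalAt (M.res h') x) = evalAt (M.res (h.trans h')) x := by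
  rw [← M.res_res h h']; rfl

theorem res_self_apply {U : Opens X} (h : U ≤ U) {n : GammaOp} (x : (M.obj U).obj n) :
    evalAt (M.res h) x = x := by
  rw [M.res_self U]; rfl

/-! ### The smash product presheaf -/

/-- Restriction maps `M(V) ∧_{O(V)} N(V) → M(U) ∧_{O(U)} N(U)`. -/
def smashRes {U V : Opens X} (h : U ≤ V) (k : GammaOp) :
    SmashObj (M.obj V) (N.obj V) k → SmashObj (M.obj U) (N.obj U) k :=
  Quot.lift (fun t => smashMk (evalAt (M.res h) t.x) (evalAt (N.res h) t.y) t.v) (by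
    rintro _ _ (⟨f, g, x, y, v⟩ | ⟨x, y, v, x', y', v', h1, h2⟩ | ⟨a, x, y, r, w, s, w', e⟩)
    · dsimp only
      rw [evalAt_map, evalAt_map]
      exact (smashMk_map f g _ _ v).symm
    · dsimp only
      rw [smashMk_point, smashMk_point]
      · exact h2.imp (fun h => by rw [h]; exact Pointed.Hom.map_point _)
          (fun h => by rw [h]; exact Pointed.Hom.map_point _)
      · exact h1.imp (fun h => by rw [h]; exact Pointed.Hom.map_point _)
          (fun h => by rw [h]; exact Pointed.Hom.map_point _)
    · dsimp only
      rw [M.res_act, N.res_act]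
      exact Quot.sound (SmashRel.balance _ _ _ r w s w' e))

/-- The presheaf `U ↦ M(U) ∧_{O(U)} N(U)`. -/
def smash : PresheafOfSMod O where
  obj U := GammaArith.smash (M.obj U) (N.obj U)
  res {U V} h :=
    { app := fun k => ⟨smashRes M N h k, smashMk_point _ _ _ (Or.inl (Pointed.Hom.map_point _))⟩
      naturality := by
        intro k k' f
        apply Pointed.Hom.ext; funext t
        obtain ⟨x, y, v⟩ := t
        rfl }
  res_self U := by
    apply NatTrans.ext; funext k; apply Pointed.Hom.ext; funext t
    obtain ⟨x, y, v⟩ := t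
    change smashMk (evalAt (M.res _) x) (evalAt (N.res _) y) v = smashMk x y v
    rw [res_self_apply, res_self_apply]
  res_res h h' := by
    apply NatTrans.ext; funext k; apply Pointed.Hom.ext; funext t
    obtain ⟨x, y, v⟩ := t
    change smashMk (evalAt (M.res _) (evalAt (M.res _) x))
      (evalAt (N.res _) (evalAt (N.res _) y)) v = smashMk (evalAt (M.res _) x) (evalAt (N.res _) y) v
    rw [res_res_apply, res_res_apply]
  res_act {U V} h {m n k} v a t := by
    obtain ⟨x, y, u⟩ := t
    change smashMk (evalAt (M.res h) ((M.obj V).act a x _)) (evalAt (N.res h) y) _ =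
      smashMk ((M.obj U).act _ (evalAt (M.res h) x) _) (evalAt (N.res h) y) _
    rw [M.res_act]

/-! ### The associated sheaf -/

/-- Sections of `M` at level `k₊` on neighbourhoods of the point `p`. -/
structure PreGerm (p : X) (k : GammaOp) where
  /-- the neighbourhood -/
  U : Opens X
  mem : p ∈ U
  /-- the section -/
  s : (M.obj U).obj k

/-- Two sections have the same germ at `p` if they agree on a neighbourhood of `p`. -/
instance germSetoid (p : X) (k : GammaOp) : Setoid (M.PreGerm p k) where
  r s t := ∃ (W : Opens X) (hs : W ≤ s.U) (ht : W ≤ t.U), p ∈ W ∧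
    evalAt (M.res hs) s.s = evalAt (M.res ht) t.s
  iseqv :=
    { refl := fun s => ⟨s.U, le_refl _, le_refl _, s.mem, rfl⟩
      symm := fun ⟨W, hs, ht, hp, e⟩ => ⟨W, ht, hs, hp, e.symm⟩
      trans := by
        rintro s t u ⟨W, hs, ht, hp, e⟩ ⟨W', ht', hu, hp', e'⟩
        refine ⟨W ⊓ W', inf_le_left.trans hs, inf_le_right.trans hu, ⟨hp, hp'⟩, ?_⟩
        rw [← M.res_res_apply inf_le_left hs, e, M.res_res_apply, ← M.res_res_apply inf_le_right hu,
          ← e', M.res_res_apply] }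

/-- The stalk of `M` at `p` at level `k₊`. -/
def Stalk (p : X) (k : GammaOp) : Type := Quotient (M.germSetoid p k)

variable {M} in
/-- The germ at `p` of a section over `U`. -/
def germ {U : Opens X} {p : X} (hp : p ∈ U) {k : GammaOp} (s : (M.obj U).obj k) : M.Stalk p k :=
  Quotient.mk _ ⟨U, hp, s⟩

theorem germ_res {U V : Opens X} (h : U ≤ V) {p : X} (hp : p ∈ U) {k : GammaOp}
    (s : (M.obj V).obj k) : germ hp (evalAt (M.res h) s) = germ (h hp) s :=
  Quotient.sound ⟨U, le_refl _, h, hp, M.res_self_apply _ _⟩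

/-- Functoriality of the stalk in `k₊`. -/
def stalkMap (p : X) {k k' : GammaOp} (f : k ⟶ k') : M.Stalk p k → M.Stalk p k' :=
  Quotient.lift (fun s => germ s.mem ((M.obj s.U).mp f s.s)) (by
    rintro s t ⟨W, hs, ht, hpW, e⟩
    rw [← M.germ_res hs hpW, ← M.germ_res ht hpW, evalAt_map, evalAt_map, e])

/-- The action of a section of `O` near `p` on the stalk at `p`. -/
def stalkAct {p : X} {U : Opens X} (hp : p ∈ U) {m n k : GammaOp} (a : (O.obj (op U)).obj m)
    (t : M.Stalk p n) (v : SmashMap m n k) : M.Stalk p k :=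
  Quotient.lift (fun s : M.PreGerm p n => (germ (⟨hp, s.mem⟩ : p ∈ U ⊓ s.U)
    ((M.obj (U ⊓ s.U)).act (resAlg O inf_le_left a) (evalAt (M.res inf_le_right) s.s) v) :
      M.Stalk p k)) (by
    rintro s t ⟨W, hs, ht, hpW, e⟩
    rw [← M.germ_res (inf_le_inf_left U hs) (⟨hp, hpW⟩ : p ∈ U ⊓ W),
      ← M.germ_res (inf_le_inf_left U ht) (⟨hp, hpW⟩ : p ∈ U ⊓ W), M.res_act, M.res_act, resAlg_res, resAlg_res,
      M.res_res_apply, M.res_res_apply, ← M.res_res_apply inf_le_right hs,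
      ← M.res_res_apply inf_le_right ht, e]) t

theorem stalkAct_germ {p : X} {U V W : Opens X} (hp : p ∈ U) (hV : p ∈ V) (hW : p ∈ W)
    (hU' : W ≤ U) (hV' : W ≤ V) {m n k : GammaOp} (a : (O.obj (op U)).obj m)
    (s : (M.obj V).obj n) (v : SmashMap m n k) :
    M.stalkAct hp a (germ hV s) v =
      germ hW ((M.obj W).act (resAlg O hU' a) (evalAt (M.res hV') s) v) := by
  change germ _ _ = _
  rw [← M.germ_res (le_inf hU' hV') hW, M.res_act, resAlg_res, M.res_res_apply]

/-- Sections over `U` of the associated sheaf at level `k₊`: families of germs that are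
locally the germs of one section of `M`. -/
structure ShSections (U : Opens X) (k : GammaOp) where
  /-- the germs of the section -/
  val : ∀ p : X, p ∈ U → M.Stalk p k
  local_germ : ∀ (p : X) (_ : p ∈ U), ∃ (V : Opens X) (h : V ≤ U) (_ : p ∈ V)
    (t : (M.obj V).obj k), ∀ (q : X) (hq : q ∈ V), val q (h hq) = germ hq t

variable {M} in
theorem ShSections.ext' {U : Opens X} {k : GammaOp} {s t : M.ShSections U k}
    (h : ∀ p hp, s.val p hp = t.val p hp) : s = t := by
  cases s; cases t
  congr
  funext p hp
  exact h p hp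

variable {M} in
/-- The section of the associated sheaf defined by a section of `M`. -/
def toSh {U : Opens X} {k : GammaOp} (t : (M.obj U).obj k) : M.ShSections U k :=
  ⟨fun _ hp => germ hp t, fun _ hp => ⟨U, le_refl _, hp, t, fun _ _ => rfl⟩⟩

/-- The sections over `U` of the associated sheaf, as a Γ-set. -/
def shGamma (U : Opens X) : GammaSet where
  obj k := Pointed.of (toSh ((M.obj U).obj k).point : M.ShSections U k)
  map {k k'} f := ⟨fun s => ⟨fun p hp => M.stalkMap p f (ShSections.val s p hp), fun p hp => by
      obtain ⟨V, h, hpV, t, ht⟩ := ShSections.local_germ s p hp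
      exact ⟨V, h, hpV, (M.obj V).mp f t, fun q hq =>
        congrArg (M.stalkMap q f) (ht q hq)⟩⟩, by
      apply ShSections.ext'; intro p hp
      change germ hp ((M.obj U).mp f _) = _
      rw [GammaSet.mp_point]
      rfl⟩
  map_id k := by
    apply Pointed.Hom.ext; funext s; apply ShSections.ext'; intro p hp
    change M.stalkMap p (𝟙 k) (ShSections.val s p hp) = ShSections.val s p hp
    obtain ⟨t, ht⟩ := Quotient.exists_rep (ShSections.val s p hp)
    rw [← ht]
    change germ t.mem ((M.obj t.U).mp _ t.s) = germ t.mem t.s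
    rw [GammaSet.mp_id]
  map_comp f g := by
    apply Pointed.Hom.ext; funext s; apply ShSections.ext'; intro p hp
    change M.stalkMap p (f ≫ g) (ShSections.val s p hp) = M.stalkMap p g (M.stalkMap p f (ShSections.val s p hp))
    obtain ⟨t, ht⟩ := Quotient.exists_rep (ShSections.val s p hp)
    rw [← ht]
    change germ t.mem ((M.obj t.U).mp _ t.s) = germ t.mem ((M.obj t.U).mp g ((M.obj t.U).mp f t.s))
    rw [GammaSet.mp_comp]
  subsingleton_zero := ⟨by
    intro s t
    apply ShSections.ext'; intro p hp
    obtain ⟨a, ha⟩ := Quotient.exists_rep (ShSections.val s p hp)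
    obtain ⟨b, hb⟩ := Quotient.exists_rep (ShSections.val t p hp)
    rw [← ha, ← hb]
    exact Quotient.sound ⟨a.U ⊓ b.U, inf_le_left, inf_le_right, ⟨a.mem, b.mem⟩,
      (M.obj _).subsingleton_zero.elim _ _⟩⟩

/-- The sections over `U` of the associated sheaf, as an `O(U)`-module. -/
def shMod (U : Opens X) : SMod (O.obj (op U)) where
  toGammaSet := M.shGamma U
  act {m n k} a s v := ⟨fun p hp => M.stalkAct hp a (ShSections.val s p hp) v, fun p hp => by
    obtain ⟨V, h, hpV, t, ht⟩ := ShSections.local_germ s p hp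
    refine ⟨V, h, hpV, (M.obj V).act (resAlg O h a) t v, fun q hq => ?_⟩
    refine (congrArg (fun z => M.stalkAct (h hq) a z v) (ht q hq)).trans ?_
    rw [M.stalkAct_germ (h hq) hq hq h le_rfl, M.res_self_apply]⟩
  act_map f g v a s := by
    apply ShSections.ext'; intro p hp
    change M.stalkAct hp _ (M.stalkMap p g (ShSections.val s p hp)) v = M.stalkAct hp a (ShSections.val s p hp) _
    obtain ⟨t, ht⟩ := Quotient.exists_rep (ShSections.val s p hp)
    rw [← ht]
    change M.stalkAct hp _ (germ t.mem ((M.obj t.U).mp g t.s)) v = germ _ _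
    rw [M.stalkAct_germ hp t.mem (⟨hp, t.mem⟩ : p ∈ U ⊓ t.U) inf_le_left inf_le_right, evalAt_map]
    rw [← (M.obj _).act_map f g v]
    congr 2
    exact evalAt_map _ _ _
  map_act v h a s := by
    apply ShSections.ext'; intro p hp
    change M.stalkMap p h (M.stalkAct hp a (ShSections.val s p hp) v) = M.stalkAct hp a (ShSections.val s p hp) _
    obtain ⟨t, ht⟩ := Quotient.exists_rep (ShSections.val s p hp)
    rw [← ht]
    change germ _ ((M.obj _).mp h _) = germ _ _
    rw [(M.obj _).map_act]
  one_act v c s := by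
    apply ShSections.ext'; intro p hp
    change M.stalkAct hp _ (ShSections.val s p hp) v = M.stalkMap p _ (ShSections.val s p hp)
    obtain ⟨t, ht⟩ := Quotient.exists_rep (ShSections.val s p hp)
    rw [← ht]
    change germ _ _ = germ t.mem ((M.obj t.U).mp _ t.s)
    rw [resAlg_one, (M.obj _).one_act, ← M.germ_res inf_le_right (⟨hp, t.mem⟩ : p ∈ _ ⊓ t.U), evalAt_map]
  mul_act v w v' w' h a b s := by
    apply ShSections.ext'; intro p hp
    change M.stalkAct hp _ (ShSections.val s p hp) w =
      M.stalkAct hp a (M.stalkAct hp b (ShSections.val s p hp) v') w'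
    obtain ⟨t, ht⟩ := Quotient.exists_rep (ShSections.val s p hp)
    rw [← ht]
    have e := M.stalkAct_germ hp t.mem (⟨hp, t.mem⟩ : p ∈ U ⊓ t.U) inf_le_left inf_le_right b t.s v'
    change M.stalkAct hp _ (germ t.mem t.s) w = M.stalkAct hp a (M.stalkAct hp b (germ t.mem t.s) v') w'
    rw [e, M.stalkAct_germ hp t.mem (⟨hp, t.mem⟩ : p ∈ U ⊓ t.U) inf_le_left inf_le_right,
      M.stalkAct_germ hp (⟨hp, t.mem⟩ : p ∈ U ⊓ t.U) (⟨hp, t.mem⟩ : p ∈ U ⊓ t.U) inf_le_left le_rfl, M.res_self_apply,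
      resAlg_mul, (M.obj _).mul_act v w v' w' h]

/-- The presheaf of `O`-modules underlying the associated sheaf. -/
def shPresheaf : PresheafOfSMod O where
  obj U := M.shMod U
  res {U V} h :=
    { app := fun k => ⟨fun s => ⟨fun p hp => ShSections.val s p (h hp), fun p hp => by
        obtain ⟨W, hW, hpW, t, ht⟩ := ShSections.local_germ s p (h hp)
        refine ⟨U ⊓ W, inf_le_left, ⟨hp, hpW⟩, evalAt (M.res inf_le_right) t, fun q hq => ?_⟩
        rw [M.germ_res]
        exact ht q hq.2⟩, by
        apply ShSections.ext'; intro p hp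
        change germ (h hp) _ = germ hp _
        rw [← M.germ_res h hp]
        congr 1
        exact Pointed.Hom.map_point _⟩
      naturality := fun _ _ _ => rfl }
  res_self U := rfl
  res_res h h' := rfl
  res_act {U V} h m n k v a s := by
    apply ShSections.ext'; intro p hp
    change M.stalkAct (h hp) a (ShSections.val s p (h hp)) v = M.stalkAct hp (resAlg O h a) (ShSections.val s p (h hp)) v
    obtain ⟨t, ht⟩ := Quotient.exists_rep (ShSections.val s p (h hp))
    rw [← ht]
    change M.stalkAct (h hp) a (germ t.mem t.s) v = M.stalkAct hp (resAlg O h a) (germ t.mem t.s) v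
    rw [M.stalkAct_germ hp t.mem (⟨hp, t.mem⟩ : p ∈ U ⊓ t.U) inf_le_left inf_le_right,
      M.stalkAct_germ (h hp) t.mem (⟨hp, t.mem⟩ : p ∈ U ⊓ t.U) (inf_le_left.trans h) inf_le_right, resAlg_res]

theorem shPresheaf_isSheaf : M.shPresheaf.IsSheaf := by
  intro ι U n s hs
  have key : ∀ (p : X) (i j : ι) (hi : p ∈ U i) (hj : p ∈ U j), ShSections.val (s i) p hi = ShSections.val (s j) p hj := by
    intro p i j hi hj
    exact congrFun (congrFun (congrArg ShSections.val (hs i j)) p) ⟨hi, hj⟩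
  have ex : ∀ p : X, p ∈ ⨆ i, U i → ∃ i, p ∈ U i := fun p hp => Opens.mem_iSup.1 hp
  refine ⟨⟨fun p hp => ShSections.val (s (ex p hp).choose) p (ex p hp).choose_spec, fun p hp => ?_⟩, ?_, ?_⟩
  · obtain ⟨i, hi⟩ := ex p hp
    obtain ⟨V, h, hpV, t, ht⟩ := ShSections.local_germ (s i) p hi
    exact ⟨V, h.trans (le_iSup U i), hpV, t, fun q hq => (key q _ i _ (h hq)).trans (ht q hq)⟩
  · intro i
    apply ShSections.ext'; intro p hp
    exact key p _ i _ hp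
  · intro t ht
    apply ShSections.ext'; intro p hp
    have e := ht (ex p hp).choose
    exact congrFun (congrFun (congrArg ShSections.val e) p) (ex p hp).choose_spec

/-- The sheaf associated to a presheaf of `O`-modules. -/
def sheafify : SheafOfSMod O := ⟨M.shPresheaf, M.shPresheaf_isSheaf⟩

end PresheafOfSMod

/-- The smash product `M ∧_O N` of sheaves of `O`-modules: the sheaf associated to the presheaf
`U ↦ M(U) ∧_{O(U)} N(U)`. -/
def SheafOfSMod.smash (M N : SheafOfSMod O) : SheafOfSMod O := (M.obj.smash N.obj).sheafify

/-- The section of `M ∧_O N` over `U` at level `k₊` defined by sections `x` of `M` and `y` of `N`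
over `U` at levels `m₊`, `n₊` and a map `v : m₊ ∧ n₊ → k₊`. -/
def SheafOfSMod.smashSec {M N : SheafOfSMod O} {U : Opens X} {m n k : GammaOp}
    (x : (M.obj.obj U).obj m) (y : (N.obj.obj U).obj n) (v : SmashMap m n k) :
    ((SheafOfSMod.smash M N).obj.obj U).obj k :=
  PresheafOfSMod.toSh (M := M.obj.smash N.obj) (smashMk x y v)

end Sheaves

/-! ## The space `Spec ℤ ∪ {∞}` -/

/-- The points of `Spec ℤ ∪ {∞}`: the generic point `(0)`, the primes, and `∞`. -/
inductive SpecZPt : Type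
  | generic
  | prime (p : Nat.Primes)
  | infty

/-- The nonempty open sets are the complements of the finite sets of points that do not
contain the generic point. -/
instance : TopologicalSpace SpecZPt where
  IsOpen U := U = ∅ ∨ (SpecZPt.generic ∈ U ∧ Uᶜ.Finite)
  isOpen_univ := Or.inr ⟨trivial, by simp⟩
  isOpen_inter := by
    rintro U V (rfl | ⟨hU, hU'⟩) (rfl | ⟨hV, hV'⟩)
    · simp
    · simp
    · simp
    · exact Or.inr ⟨⟨hU, hV⟩, by rw [Set.compl_inter]; exact hU'.union hV'⟩
  isOpen_sUnion := by
    intro S hS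
    by_cases h : ∃ U ∈ S, U ≠ ∅
    · obtain ⟨U, hU, hne⟩ := h
      obtain ⟨h1, h2⟩ := (hS U hU).resolve_left hne
      exact Or.inr ⟨⟨U, hU, h1⟩,
        h2.subset (Set.compl_subset_compl.2 (Set.subset_sUnion_of_mem hU))⟩
    · push Not at h
      left
      rw [Set.sUnion_eq_empty]
      exact h

/-- The Arakelov compactification of `Spec ℤ`, as a topological space. -/
abbrev SpecZBar : TopCat.{0} := TopCat.of SpecZPt

theorem generic_mem {U : Opens SpecZBar} (h : U ≠ ⊥) : SpecZPt.generic ∈ U := by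
  rcases U.2 with h' | h'
  · exact absurd (Opens.ext h') h
  · exact h'.1

/-- Divisors on `Spec ℤ`. -/
abbrev FinDivisor : Type := Nat.Primes →₀ ℤ

/-- Arakelov divisors `D = (D_finite, a)`, where `D_∞ = a {∞}`. -/
abbrev ArakelovDivisor : Type := FinDivisor × ℝ

/-- The finite part `∑ ord_p(q) p` of the principal divisor of `q`. -/
noncomputable def principalFin (q : ℚˣ) : FinDivisor :=
  Finsupp.ofSupportFinite (fun p => padicValRat p (q : ℚ)) (by
    have hf : ∀ n : ℕ, n ≠ 0 → {p : Nat.Primes | (p : ℕ) ∣ n}.Finite := fun n hn =>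
      Set.Finite.of_finite_image (f := fun p : Nat.Primes => (p : ℕ))
        ((n.divisors.finite_toSet).subset (by
          rintro _ ⟨p, hp, rfl⟩
          exact Nat.mem_divisors.2 ⟨hp, hn⟩))
        (fun a _ b _ h => Subtype.ext h)
    refine ((hf (q : ℚ).num.natAbs (by simp)).union (hf (q : ℚ).den (q : ℚ).den_nz)).subset ?_
    intro p hp
    by_contra hc
    rw [Set.mem_union, not_or] at hc
    apply hp
    have h1 : padicValNat p (q : ℚ).num.natAbs = 0 := padicValNat.eq_zero_of_not_dvd hc.1
    have h2 : padicValNat p (q : ℚ).den = 0 := padicValNat.eq_zero_of_not_dvd hc.2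
    simp [padicValRat, padicValInt, h1, h2])

/-- The principal divisor `(q) = (q)_finite - log |q| {∞}`. -/
noncomputable def principal (q : ℚˣ) : ArakelovDivisor :=
  (principalFin q, -Real.log |((q : ℚ) : ℝ)|)

/-- The sections over `U ∩ Spec ℤ` of the sheaf `O(D)` of a divisor `D` on `Spec ℤ`, viewed as a
subgroup of `ℚ`; the value on the empty set is zero. -/
def finSections (D : FinDivisor) (U : Opens SpecZBar) : AddSubgroup ℚ where
  carrier := {q | (∀ p : Nat.Primes, SpecZPt.prime p ∈ U → q = 0 ∨ 0 ≤ padicValRat p q + D p) ∧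
    (U = ⊥ → q = 0)}
  zero_mem' := ⟨fun _ _ => Or.inl rfl, fun _ => rfl⟩
  neg_mem' := fun {q} h => ⟨fun p hp => by
    rw [padicValRat.neg, neg_eq_zero]; exact h.1 p hp, fun hU => by rw [h.2 hU, neg_zero]⟩
  add_mem' := fun {q r} hq hr => ⟨fun p hp => by
    have : Fact (p : ℕ).Prime := ⟨p.2⟩
    by_cases h : q + r = 0
    · exact Or.inl h
    rcases hq.1 p hp with rfl | hq1
    · rw [zero_add]; exact hr.1 p hp
    rcases hr.1 p hp with rfl | hr1
    · rw [add_zero]; exact Or.inr hq1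
    refine Or.inr ?_
    have := padicValRat.min_le_padicValRat_add (p := p) h
    rcases min_le_iff.1 this with h' | h' <;> omega, fun hU => by rw [hq.2 hU, hr.2 hU, add_zero]⟩

theorem finSections_mul {D D' : FinDivisor} {U : Opens SpecZBar} {q r : ℚ}
    (hq : q ∈ finSections D U) (hr : r ∈ finSections D' U) : q * r ∈ finSections (D + D') U :=
  ⟨fun p hp => by
    have : Fact (p : ℕ).Prime := ⟨p.2⟩
    by_cases h0 : q = 0
    · exact Or.inl (by rw [h0, zero_mul])
    by_cases h1 : r = 0
    · exact Or.inl (by rw [h1, mul_zero])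
    have h2 := (hq.1 p hp).resolve_left h0
    have h3 := (hr.1 p hp).resolve_left h1
    refine Or.inr ?_
    rw [padicValRat.mul h0 h1, Finsupp.add_apply]
    omega, fun hU => by rw [hq.2 hU, zero_mul]⟩

/-- The image in `ℚ` of the unit section over `U`: it is `1`, except that it is `0` on the empty
set, where all sections vanish. Multiplication by it is the restriction to `U`. -/
noncomputable def unitSec (U : Opens SpecZBar) : ℚ :=
  letI := Classical.propDecidable (U = ⊥)
  if U = ⊥ then 0 else 1

theorem unitSec_bot : unitSec ⊥ = 0 := by simp [unitSec]

theorem unitSec_of_ne {U : Opens SpecZBar} (h : U ≠ ⊥) : unitSec U = 1 := by simp [unitSec, h]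

theorem unitSec_mul {D : FinDivisor} {U : Opens SpecZBar} {q : ℚ} (hq : q ∈ finSections D U) :
    unitSec U * q = q := by
  by_cases h : U = ⊥
  · rw [hq.2 h, mul_zero]
  · rw [unitSec_of_ne h, one_mul]

theorem unitSec_mul_unitSec {U V : Opens SpecZBar} (h : U ≤ V) :
    unitSec U * unitSec V = unitSec U := by
  by_cases hU : U = ⊥
  · rw [hU, unitSec_bot, zero_mul]
  · rw [unitSec_of_ne (U := V) (fun hV => hU (le_bot_iff.1 (hV ▸ h))), mul_one]

theorem unitSec_mem (U : Opens SpecZBar) : unitSec U ∈ finSections 0 U :=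
  ⟨fun p _ => by
    by_cases h : U = ⊥
    · exact Or.inl (by rw [h, unitSec_bot])
    · exact Or.inr (by rw [unitSec_of_ne h]; simp), fun h => by rw [h, unitSec_bot]⟩

theorem abs_unitSec_le (U : Opens SpecZBar) : |unitSec U| ≤ 1 := by
  by_cases h : U = ⊥
  · rw [h, unitSec_bot]; simp
  · rw [unitSec_of_ne h]; simp

theorem res_mem (D : FinDivisor) {U V : Opens SpecZBar} (h : U ≤ V) {q : ℚ}
    (hq : q ∈ finSections D V) : unitSec U * q ∈ finSections D U := by
  by_cases hU : U = ⊥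
  · rw [hU, unitSec_bot, zero_mul]; exact zero_mem _
  · rw [unitSec_of_ne hU, one_mul]
    exact ⟨fun p hp => hq.1 p (h hp), fun h' => absurd h' hU⟩

/-! ## The Γ-set `Hℚ` -/

/-- `Hℚ(f)(φ)(j) = ∑ φ(i)` over the `i` with `f(i) = j`. -/
def push {m n : GammaOp} (f : m ⟶ n) (φ : Fin m.card → ℚ) : Fin n.card → ℚ :=
  fun j => ∑ i, if PMap.toFun f (some i) = some j then φ i else 0

/-- The image of `(i, j) ↦ φ(i) ψ(j)` under `v : m₊ ∧ n₊ → k₊`. -/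
def prod {m n k : GammaOp} (φ : Fin m.card → ℚ) (ψ : Fin n.card → ℚ) (v : SmashMap m n k) :
    Fin k.card → ℚ :=
  fun l => ∑ i, ∑ j, if v.toFun (some i) (some j) = some l then φ i * ψ j else 0

/-- The function `e δ_c`. -/
def delta (e : ℚ) {n : GammaOp} (c : n.Pt) : Fin n.card → ℚ :=
  fun i => if c = some i then e else 0

/-- The sum `∑ |φ(i)|`. -/
noncomputable def sumAbs {n : GammaOp} (φ : Fin n.card → ℚ) : ℝ := ∑ i, |((φ i : ℚ) : ℝ)|

theorem sum_ite_some {R : Type} [AddCommMonoid R] {n : GammaOp} (o : n.Pt) (F : n.Pt → R)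
    (h : F none = 0) : (∑ l, if o = some l then F (some l) else 0) = F o := by
  cases o with
  | none => simp [h]
  | some c => simp

/-- The pairing `∑ φ(i) F(i)`. -/
def pair {n : GammaOp} (φ : Fin n.card → ℚ) (F : n.Pt → ℚ) : ℚ := ∑ i, φ i * F (some i)

theorem pair_ext {n : GammaOp} {φ ψ : Fin n.card → ℚ}
    (h : ∀ F : n.Pt → ℚ, F none = 0 → pair φ F = pair ψ F) : φ = ψ := by
  funext i
  have := h (fun o => if o = some i then 1 else 0) (by simp)
  simpa [pair] using this

theorem pair_push {m n : GammaOp} (f : m ⟶ n) (φ : Fin m.card → ℚ) (F : n.Pt → ℚ)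
    (h : F none = 0) : pair (push f φ) F = pair φ (fun x => F (PMap.toFun f x)) := by
  simp only [pair, push, Finset.sum_mul]
  rw [Finset.sum_comm]
  refine Finset.sum_congr rfl fun i _ => ?_
  rw [← sum_ite_some (PMap.toFun f (some i)) (fun o => φ i * F o) (by simp [h])]
  refine Finset.sum_congr rfl fun l _ => ?_
  split_ifs <;> simp

theorem pair_prod {m n k : GammaOp} (φ : Fin m.card → ℚ) (ψ : Fin n.card → ℚ)
    (v : SmashMap m n k) (F : k.Pt → ℚ) (h : F none = 0) :
    pair (prod φ ψ v) F = pair φ (fun x => pair ψ (fun y => F (v.toFun x y))) := by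
  simp only [pair, prod, Finset.sum_mul, Finset.mul_sum]
  rw [Finset.sum_comm]
  refine Finset.sum_congr rfl fun i _ => ?_
  rw [Finset.sum_comm]
  refine Finset.sum_congr rfl fun j _ => ?_
  rw [← mul_assoc, ← sum_ite_some (v.toFun (some i) (some j)) (fun o => φ i * ψ j * F o)
    (by simp [h])]
  refine Finset.sum_congr rfl fun l _ => ?_
  split_ifs <;> simp

theorem pair_delta (e : ℚ) {n : GammaOp} (c : n.Pt) (F : n.Pt → ℚ) (h : F none = 0) :
    pair (delta e c) F = e * F c := by
  rw [← sum_ite_some c (fun o => e * F o) (by simp [h])]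
  refine Finset.sum_congr rfl fun l _ => ?_
  simp only [delta]
  split_ifs <;> simp

theorem pair_mul (e : ℚ) {n : GammaOp} (φ : Fin n.card → ℚ) (F : n.Pt → ℚ) :
    pair (fun i => e * φ i) F = e * pair φ F := by
  simp [pair, Finset.mul_sum, mul_assoc]

theorem pair_zero {n : GammaOp} (φ : Fin n.card → ℚ) : pair φ (fun _ => 0) = 0 := by simp [pair]

theorem pair_comm {m n : GammaOp} (φ : Fin m.card → ℚ) (ψ : Fin n.card → ℚ)
    (F : m.Pt → n.Pt → ℚ) :
    pair φ (fun x => pair ψ (fun y => F x y)) = pair ψ (fun y => pair φ (fun x => F x y)) := by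
  simp only [pair, Finset.mul_sum]
  rw [Finset.sum_comm]
  refine Finset.sum_congr rfl fun i _ => Finset.sum_congr rfl fun j _ => by ring

theorem push_id {n : GammaOp} (φ : Fin n.card → ℚ) : push (𝟙 n) φ = φ :=
  pair_ext fun F hF => by rw [pair_push _ _ _ hF]; rfl

theorem push_comp {m n k : GammaOp} (f : m ⟶ n) (g : n ⟶ k) (φ : Fin m.card → ℚ) :
    push (f ≫ g) φ = push g (push f φ) :=
  pair_ext fun F hF => by
    rw [pair_push _ _ _ hF, pair_push _ _ _ hF, pair_push _ _ _ (by rw [PMap.map_none, hF])]; rfl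

theorem prod_push {m n m' n' k : GammaOp} (f : m ⟶ m') (g : n ⟶ n') (v : SmashMap m' n' k)
    (φ : Fin m.card → ℚ) (ψ : Fin n.card → ℚ) :
    prod (push f φ) (push g ψ) v = prod φ ψ (v.pre f g) :=
  pair_ext fun F hF => by
    rw [pair_prod _ _ _ _ hF, pair_prod _ _ _ _ hF, pair_push]
    · congr 1; funext x
      rw [pair_push _ _ _ (by rw [v.right_none, hF])]; rfl
    · simp [v.left_none, hF, pair_zero]

theorem push_prod {m n k k' : GammaOp} (v : SmashMap m n k) (h : k ⟶ k')
    (φ : Fin m.card → ℚ) (ψ : Fin n.card → ℚ) : push h (prod φ ψ v) = prod φ ψ (v.post h) :=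
  pair_ext fun F hF => by
    rw [pair_push _ _ _ hF, pair_prod _ _ _ _ hF, pair_prod _ _ _ _ (by rw [PMap.map_none, hF])]
    rfl

theorem prod_delta (e : ℚ) {m n k : GammaOp} (v : SmashMap m n k) (c : m.Pt)
    (ψ : Fin n.card → ℚ) (h : ∀ i, e * ψ i = ψ i) :
    prod (delta e c) ψ v = push (v.slice c) ψ :=
  pair_ext fun F hF => by
    rw [pair_prod _ _ _ _ hF, pair_delta, pair_push _ _ _ hF, ← pair_mul]
    · simp only [h]; rfl
    · simp [v.left_none, hF, pair_zero]

theorem prod_assoc {l m n p p' q : GammaOp} (v : SmashMap l m p) (w : SmashMap p n q)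
    (v' : SmashMap m n p') (w' : SmashMap l p' q)
    (h : ∀ c x y, w.toFun (v.toFun c x) y = w'.toFun c (v'.toFun x y))
    (φ : Fin l.card → ℚ) (ψ : Fin m.card → ℚ) (χ : Fin n.card → ℚ) :
    prod (prod φ ψ v) χ w = prod φ (prod ψ χ v') w' :=
  pair_ext fun F hF => by
    rw [pair_prod _ _ _ _ hF, pair_prod _ _ _ _ hF, pair_prod]
    · congr 1; funext x
      rw [pair_prod _ _ _ _ (by rw [w'.right_none, hF])]
      simp only [h]
    · simp [w.left_none, hF, pair_zero]

theorem prod_comm {m n k : GammaOp} (v : SmashMap m n k) (φ : Fin m.card → ℚ)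
    (ψ : Fin n.card → ℚ) : prod φ ψ v = prod ψ φ v.swap :=
  pair_ext fun F hF => by
    rw [pair_prod _ _ _ _ hF, pair_prod _ _ _ _ hF, pair_comm]; rfl

theorem push_mul (e : ℚ) {m n : GammaOp} (f : m ⟶ n) (φ : Fin m.card → ℚ) :
    push f (fun i => e * φ i) = fun j => e * push f φ j :=
  pair_ext fun F hF => by
    rw [pair_push _ _ _ hF, pair_mul, pair_mul, pair_push _ _ _ hF]

theorem prod_mul (e : ℚ) (he : e * e = e) {m n k : GammaOp} (v : SmashMap m n k)
    (φ : Fin m.card → ℚ) (ψ : Fin n.card → ℚ) :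
    prod (fun i => e * φ i) (fun i => e * ψ i) v = fun j => e * prod φ ψ v j :=
  pair_ext fun F hF => by
    rw [pair_prod _ _ _ _ hF, pair_mul, pair_mul, pair_prod _ _ _ _ hF, ← pair_mul]
    simp only [pair, Finset.mul_sum]
    refine Finset.sum_congr rfl fun i _ => Finset.sum_congr rfl fun j _ => ?_
    linear_combination (φ i * (ψ j * F (v.toFun (some i) (some j)))) * he

theorem delta_map (e : ℚ) {m n : GammaOp} (f : m ⟶ n) (c : m.Pt) :
    delta e (PMap.toFun f c) = push f (delta e c) :=
  pair_ext fun F hF => by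
    rw [pair_push _ _ _ hF, pair_delta _ _ _ hF, pair_delta _ _ _ (by rw [PMap.map_none, hF])]

theorem sum_ite_some_le {n : GammaOp} (o : n.Pt) (t : ℝ) (ht : 0 ≤ t) :
    (∑ l, if o = some l then t else 0) ≤ t := by
  cases o with
  | none => simpa using ht
  | some c => simp

theorem sumAbs_nonneg {n : GammaOp} (φ : Fin n.card → ℚ) : 0 ≤ sumAbs φ :=
  Finset.sum_nonneg fun _ _ => abs_nonneg _

theorem sumAbs_push_le {m n : GammaOp} (f : m ⟶ n) (φ : Fin m.card → ℚ) :
    sumAbs (push f φ) ≤ sumAbs φ := by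
  calc sumAbs (push f φ)
      ≤ ∑ j, ∑ i, if PMap.toFun f (some i) = some j then |((φ i : ℚ) : ℝ)| else 0 := by
        refine Finset.sum_le_sum fun j _ => ?_
        rw [push, Rat.cast_sum]
        refine (Finset.abs_sum_le_sum_abs _ _).trans (Finset.sum_le_sum fun i _ => ?_)
        split_ifs <;> simp
    _ ≤ sumAbs φ := by
        rw [Finset.sum_comm]
        exact Finset.sum_le_sum fun i _ => sum_ite_some_le _ _ (abs_nonneg _)

theorem sumAbs_prod_le {m n k : GammaOp} (v : SmashMap m n k) (φ : Fin m.card → ℚ)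
    (ψ : Fin n.card → ℚ) : sumAbs (prod φ ψ v) ≤ sumAbs φ * sumAbs ψ := by
  calc sumAbs (prod φ ψ v)
      ≤ ∑ l, ∑ i, ∑ j, if v.toFun (some i) (some j) = some l
          then |((φ i : ℚ) : ℝ)| * |((ψ j : ℚ) : ℝ)| else 0 := by
        refine Finset.sum_le_sum fun l _ => ?_
        rw [prod, Rat.cast_sum]
        refine (Finset.abs_sum_le_sum_abs _ _).trans (Finset.sum_le_sum fun i _ => ?_)
        rw [Rat.cast_sum]
        refine (Finset.abs_sum_le_sum_abs _ _).trans (Finset.sum_le_sum fun j _ => ?_)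
        split_ifs <;> simp [abs_mul]
    _ ≤ sumAbs φ * sumAbs ψ := by
        rw [Finset.sum_comm, sumAbs, sumAbs, Finset.sum_mul_sum]
        refine Finset.sum_le_sum fun i _ => ?_
        rw [Finset.sum_comm]
        exact Finset.sum_le_sum fun j _ => sum_ite_some_le _ _ (by positivity)

theorem sumAbs_delta_le (e : ℚ) (he : |e| ≤ 1) {n : GammaOp} (c : n.Pt) :
    sumAbs (delta e c) ≤ 1 := by
  have he' : |(e : ℝ)| ≤ 1 := by exact_mod_cast he
  refine le_trans ?_ ((sum_ite_some_le c |(e : ℝ)| (abs_nonneg _)).trans he')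
  refine Finset.sum_le_sum fun i _ => ?_
  rw [delta]
  split_ifs <;> simp

theorem sumAbs_mul_le (e : ℚ) (he : |e| ≤ 1) {n : GammaOp} (φ : Fin n.card → ℚ) :
    sumAbs (n := n) (fun i => e * φ i) ≤ sumAbs φ := by
  have he' : |(e : ℝ)| ≤ 1 := by exact_mod_cast he
  refine Finset.sum_le_sum fun i _ => ?_
  rw [Rat.cast_mul, abs_mul]
  exact mul_le_of_le_one_left (abs_nonneg _) he'

/-! ## The structure sheaf and the sheaves `O(D)` -/

/-- The elements of `‖H O(D)(U ∩ Spec ℤ)‖_B (k₊)`: the `φ` in `H O(D)(U ∩ Spec ℤ)(k₊)` that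
satisfy moreover, if `∞ ∈ U`, the condition `∑ |φ(i)| ∈ B`. The lower set `B` is
`{t | t ≤ λ}` or `{t | t < λ}`. -/
@[ext]
structure NormSec (D : FinDivisor) (B : LowerSet ℝ) (U : Opens SpecZBar) (k : GammaOp) where
  /-- the underlying element of `Hℚ(k₊)` -/
  val : Fin k.card → ℚ
  mem : ∀ i, val i ∈ finSections D U
  bound : SpecZPt.infty ∈ U → sumAbs val ∈ B

section NormSheaf

variable (D : FinDivisor) (B : LowerSet ℝ) (hB : (0 : ℝ) ∈ B)

/-- The Γ-set of the sections over `U`. -/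
def normGamma (U : Opens SpecZBar) : GammaSet where
  obj k := Pointed.of (⟨fun _ => 0, fun _ => zero_mem _, fun _ => by simpa [sumAbs] using hB⟩ :
    NormSec D B U k)
  map f := ⟨fun φ => ⟨push f φ.val, fun j => sum_mem fun i _ => by
      split_ifs
      · exact φ.mem i
      · exact zero_mem _, fun h => B.lower (sumAbs_push_le f φ.val) (φ.bound h)⟩, by
      apply NormSec.ext; funext j; simp [push]⟩
  map_id k := by
    apply Pointed.Hom.ext; funext φ; exact NormSec.ext (push_id _)
  map_comp f g := by
    apply Pointed.Hom.ext; funext φ; exact NormSec.ext (push_comp f g _)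
  subsingleton_zero := ⟨fun φ ψ => NormSec.ext (funext fun i => i.elim0)⟩

variable {D B} in
/-- The product of a section of `O` and a section of a sheaf `‖H O(D)‖_B`. -/
def normMul {U : Opens SpecZBar} {m n k : GammaOp} (a : NormSec 0 (LowerSet.Iic 1) U m)
    (x : NormSec D B U n) (v : SmashMap m n k) : NormSec D B U k where
  val := prod a.val x.val v
  mem l := sum_mem fun i _ => sum_mem fun j _ => by
    split_ifs
    · simpa using finSections_mul (a.mem i) (x.mem j)
    · exact zero_mem _
  bound h := B.lower ((sumAbs_prod_le v a.val x.val).trans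
    (mul_le_of_le_one_left (sumAbs_nonneg _) (a.bound h))) (x.bound h)

variable {D B} in
/-- The restriction of sections. -/
noncomputable def normRes {U V : Opens SpecZBar} (h : U ≤ V) {k : GammaOp} (x : NormSec D B V k) :
    NormSec D B U k where
  val i := unitSec U * x.val i
  mem i := res_mem D h (x.mem i)
  bound hU := B.lower (sumAbs_mul_le _ (abs_unitSec_le U) _) (x.bound (h hU))

theorem zero_mem_Iic_one : (0 : ℝ) ∈ LowerSet.Iic (1 : ℝ) := zero_le_one (α := ℝ)

/-- The `𝕊`-algebra `O(U) = ‖H O(U ∩ Spec ℤ)‖_1` (and `H O(U)` if `∞ ∉ U`). -/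
noncomputable def structAlg (U : Opens SpecZBar) : CommSAlg where
  toGammaSet := normGamma 0 (LowerSet.Iic 1) zero_mem_Iic_one U
  one :=
    { app := fun n => ⟨fun c => ⟨delta (unitSec U) c, fun i => by
          unfold delta
          split_ifs
          · exact unitSec_mem U
          · exact zero_mem _, fun _ => sumAbs_delta_le _ (abs_unitSec_le U) c⟩, by
          apply NormSec.ext; funext i; rfl⟩
      naturality := fun m n f => by
        apply Pointed.Hom.ext; funext c; exact NormSec.ext (delta_map _ f c) }
  mul a b v := normMul a b v
  mul_map f g v a b := NormSec.ext (prod_push f g v _ _)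
  map_mul v h a b := NormSec.ext (push_prod v h _ _)
  one_mul v c b := NormSec.ext (prod_delta _ v c _ fun i => unitSec_mul (b.mem i))
  mul_assoc v w v' w' h a b c := NormSec.ext (prod_assoc v w v' w' h _ _ _)
  mul_comm v a b := NormSec.ext (prod_comm v _ _)

/-- The restriction maps as morphisms of Γ-sets. -/
noncomputable def normResNat {U V : Opens SpecZBar} (h : U ≤ V) :
    (normGamma D B hB V).toFunctor ⟶ (normGamma D B hB U).toFunctor where
  app k := ⟨fun x => normRes h x, by apply NormSec.ext; funext i; exact mul_zero _⟩
  naturality _ _ f := by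
    apply Pointed.Hom.ext; funext x; exact NormSec.ext (push_mul _ f _).symm

theorem normResNat_self (U : Opens SpecZBar) : normResNat D B hB (le_refl U) = 𝟙 _ := by
  apply NatTrans.ext; funext k; apply Pointed.Hom.ext; funext x
  exact NormSec.ext (funext fun i => unitSec_mul (NormSec.mem x i))

theorem normResNat_comp {U V W : Opens SpecZBar} (h : U ≤ V) (h' : V ≤ W) :
    normResNat D B hB h' ≫ normResNat D B hB h = normResNat D B hB (h.trans h') := by
  apply NatTrans.ext; funext k; apply Pointed.Hom.ext; funext x
  refine NormSec.ext (funext fun i => ?_)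
  change unitSec U * (unitSec V * NormSec.val x i) = unitSec U * NormSec.val x i
  rw [← mul_assoc, unitSec_mul_unitSec h]

/-- The structure sheaf `O` of `Spec ℤ ∪ {∞}`. Its underlying presheaf of Γ-sets is that of
`normPresheaf 0 (LowerSet.Iic 1)` below, hence a sheaf by `normPresheaf_isSheaf`. -/
noncomputable def structSheaf : TopCat.Presheaf CommSAlg SpecZBar where
  obj U := structAlg U.unop
  map {V U} h :=
    { nat := normResNat 0 (LowerSet.Iic 1) zero_mem_Iic_one (leOfHom h.unop)
      map_one := by
        apply NatTrans.ext; funext k; apply Pointed.Hom.ext; funext c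
        refine NormSec.ext (funext fun i => ?_)
        change unitSec U.unop * delta (unitSec V.unop) c i = delta (unitSec U.unop) c i
        simp only [delta]
        split_ifs
        · exact unitSec_mul_unitSec (leOfHom h.unop)
        · exact mul_zero _
      map_mul := fun v a b =>
        NormSec.ext (prod_mul _ (unitSec_mul_unitSec le_rfl) v _ _).symm }
  map_id U := CommSAlg.Hom.ext (normResNat_self 0 _ _ U.unop)
  map_comp f g := CommSAlg.Hom.ext (normResNat_comp 0 _ _ (leOfHom g.unop) (leOfHom f.unop)).symm

/-- The presheaf of `O`-modules `‖H O(D)‖_B`. -/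
noncomputable def normPresheaf : PresheafOfSMod structSheaf where
  obj U :=
    { toGammaSet := normGamma D B hB U
      act := fun a x v => normMul a x v
      act_map := fun f g v _ _ => NormSec.ext (prod_push f g v _ _)
      map_act := fun v h _ _ => NormSec.ext (push_prod v h _ _)
      one_act := fun v c x => NormSec.ext (prod_delta _ v c _ fun i => unitSec_mul (NormSec.mem x i))
      mul_act := fun v w v' w' h _ _ _ => NormSec.ext (prod_assoc v w v' w' h _ _ _) }
  res h := normResNat D B hB h
  res_self U := normResNat_self D B hB U
  res_res h h' := normResNat_comp D B hB h h'
  res_act _ _ _ _ v _ _ := NormSec.ext (prod_mul _ (unitSec_mul_unitSec le_rfl) v _ _).symm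

theorem normPresheaf_isSheaf : (normPresheaf D B hB).IsSheaf := by
  intro ι U n s hs
  have hs' : ∀ i j, U i ≠ ⊥ → U j ≠ ⊥ → NormSec.val (s i) = NormSec.val (s j) := by
    intro i j hi hj
    have hij : U i ⊓ U j ≠ ⊥ := fun h => by
      have : SpecZPt.generic ∈ U i ⊓ U j := ⟨generic_mem hi, generic_mem hj⟩
      rw [h] at this
      exact this
    have e := congrArg NormSec.val (hs i j)
    funext l
    have e' := congrFun e l
    change unitSec (U i ⊓ U j) * NormSec.val (s i) l =
      unitSec (U i ⊓ U j) * NormSec.val (s j) l at e'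
    rwa [unitSec_of_ne hij, one_mul, one_mul] at e'
  have bot_zero : ∀ (V : Opens SpecZBar) (x y : NormSec D B V n), V = ⊥ → x = y := by
    intro V x y hV
    refine NormSec.ext (funext fun i => ?_)
    rw [(x.mem i).2 hV, (y.mem i).2 hV]
  by_cases hne : ∃ i, U i ≠ ⊥
  · obtain ⟨i, hi⟩ := hne
    have hU : (⨆ i, U i) ≠ ⊥ := fun h => hi (le_bot_iff.1 (h ▸ le_iSup U i))
    have val_res : ∀ (t : NormSec D B (⨆ i, U i) n) (j : ι), U j ≠ ⊥ →
        NormSec.val (evalAt ((normPresheaf D B hB).res (le_iSup U j)) t) = t.val := by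
      intro t j hj
      funext l
      change unitSec (U j) * t.val l = t.val l
      rw [unitSec_of_ne hj, one_mul]
    have hval : ∀ (q : SpecZPt) (j : ι), q ∈ U j → NormSec.val (s i) = NormSec.val (s j) := by
      intro q j hq
      refine hs' i j hi fun h => ?_
      rw [h] at hq
      exact hq
    refine ⟨(⟨NormSec.val (s i), fun l => ⟨fun p hp => ?_, fun h => absurd h hU⟩, fun h => ?_⟩ :
      NormSec D B (⨆ i, U i) n), fun j => ?_, fun t ht => ?_⟩
    · obtain ⟨j, hj⟩ := Opens.mem_iSup.1 hp
      rw [hval _ j hj]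
      exact (NormSec.mem (s j) l).1 p hj
    · obtain ⟨j, hj⟩ := Opens.mem_iSup.1 h
      rw [hval _ j hj]
      exact NormSec.bound (s j) hj
    · by_cases hj : U j = ⊥
      · exact bot_zero _ _ _ hj
      · exact NormSec.ext ((val_res _ j hj).trans (hs' i j hi hj))
    · refine NormSec.ext ?_
      rw [← val_res t i hi, ht i]
  · push Not at hne
    have hU : (⨆ i, U i) = ⊥ := by rw [iSup_eq_bot]; exact hne
    exact ⟨((normPresheaf D B hB).obj _).obj n |>.point, fun i => bot_zero _ _ _ (hne i),
      fun t _ => bot_zero _ _ _ hU⟩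

/-- The sheaf of `O`-modules `‖H O(D)‖_B`. -/
noncomputable def normSheaf : SheafOfSMod structSheaf :=
  ⟨normPresheaf D B hB, normPresheaf_isSheaf D B hB⟩

end NormSheaf

/-- The sheaf of `O`-modules `O(D)` of an Arakelov divisor `D = (D_finite, a)`:
`O(D)(U) = ‖H O(D_finite)(U ∩ Spec ℤ)‖_{e^a}` for `∞ ∈ U`, and `H O(D_finite)(U)` otherwise. -/
noncomputable def sheafO (D : ArakelovDivisor) : SheafOfSMod structSheaf :=
  normSheaf D.1 (LowerSet.Iic (Real.exp D.2)) (Real.exp_nonneg _)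

/-- The sheaf `O_ε`, with `O_ε(U) = ‖H O(U ∩ Spec ℤ)‖_{<1}` for `∞ ∈ U`, and `H O(U)` otherwise. -/
noncomputable def sheafEps : SheafOfSMod structSheaf :=
  normSheaf 0 (LowerSet.Iio 1) (zero_lt_one (α := ℝ))

/-- The bilinear maps `O(D)(U)(m₊) × O(D')(U)(n₊) → O(D + D')(U)(k₊)`, for `v : m₊ ∧ n₊ → k₊`,
given by the product of `ℚ`. -/
noncomputable def mulSec {D D' : ArakelovDivisor} {U : Opens SpecZBar} {m n k : GammaOp}
    (x : ((sheafO D).obj.obj U).obj m) (y : ((sheafO D').obj.obj U).obj n) (v : SmashMap m n k) :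
    ((sheafO (D + D')).obj.obj U).obj k :=
  (⟨prod (NormSec.val x) (NormSec.val y) v, fun _ => sum_mem fun i _ => sum_mem fun j _ => by
    split_ifs
    · exact finSections_mul (NormSec.mem x i) (NormSec.mem y j)
    · exact zero_mem _, fun h => by
    have hx : sumAbs (NormSec.val x) ≤ Real.exp D.2 := NormSec.bound x h
    have hy : sumAbs (NormSec.val y) ≤ Real.exp D'.2 := NormSec.bound y h
    change sumAbs _ ≤ Real.exp (D.2 + D'.2)
    rw [Real.exp_add]
    exact (sumAbs_prod_le v _ _).trans
      (mul_le_mul hx hy (sumAbs_nonneg _) (Real.exp_nonneg _))⟩ :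
    NormSec (D.1 + D'.1) (LowerSet.Iic (Real.exp (D.2 + D'.2))) U k)

/-- The exceptional case: `e^a` and `e^{a'}` are irrational and their product is rational. -/
def Exceptional (D D' : ArakelovDivisor) : Prop :=
  Irrational (Real.exp D.2) ∧ Irrational (Real.exp D'.2) ∧
    ¬ Irrational (Real.exp D.2 * Real.exp D'.2)

/-- Equivalence of Arakelov divisors modulo principal divisors. -/
def PrincipallyEquivalent (D D' : ArakelovDivisor) : Prop :=
  ∃ q : ℚˣ, D' - D = principal q

end GammaArith

open GammaArith

namespace GammaArith

/-! ## Locally bijective morphisms of presheaves of modules -/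

namespace PresheafOfSMod

variable {X : TopCat.{0}} {O : TopCat.Presheaf CommSAlg X} {M N P F : PresheafOfSMod O}

theorem Hom.app_res_apply (f : M ⟶ N) {U V : Opens X} (h : U ≤ V) {n : GammaOp}
    (x : (M.obj V).obj n) :
    evalAt (Hom.app f U) (evalAt (M.res h) x) = evalAt (N.res h) (evalAt (Hom.app f V) x) :=
  (congrArg (fun φ : (M.obj V).toFunctor ⟶ (N.obj U).toFunctor => evalAt φ x)
    (Hom.app_res f h)).symm

theorem hom_ext_apply {f g : M ⟶ N}
    (h : ∀ (U : Opens X) (n : GammaOp) (x : (M.obj U).obj n),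
      evalAt (Hom.app f U) x = evalAt (Hom.app g U) x) : f = g := by
  apply Hom.ext
  funext U
  apply NatTrans.ext
  funext n
  apply Pointed.Hom.ext
  funext x
  exact h U n x

/-- The inverse of a morphism that is bijective on sections. -/
noncomputable def inverseOfBijective (f : M ⟶ N)
    (hf : ∀ (U : Opens X) (n : GammaOp),
      Function.Bijective fun x : (M.obj U).obj n => evalAt (Hom.app f U) x) : N ⟶ M where
  app U :=
    { app := fun n => ⟨(Equiv.ofBijective _ (hf U n)).symm, by
        rw [Equiv.symm_apply_eq]
        exact (Pointed.Hom.map_point ((Hom.app f U).app n)).symm⟩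
      naturality := fun m n g => by
        apply Pointed.Hom.ext
        funext y
        apply (hf U n).1
        obtain ⟨x, rfl⟩ := (hf U m).2 y
        have h : (Equiv.ofBijective _ (hf U m)).symm (evalAt (Hom.app f U) x) = x :=
          (Equiv.ofBijective _ (hf U m)).symm_apply_apply x
        change evalAt (Hom.app f U) ((Equiv.ofBijective _ (hf U n)).symm _) =
          evalAt (Hom.app f U) ((M.obj U).mp g ((Equiv.ofBijective _ (hf U m)).symm _))
        rw [h, evalAt_map]
        exact (Equiv.ofBijective _ (hf U n)).apply_symm_apply _ }
  app_res {U V} h := by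
    apply NatTrans.ext
    funext n
    apply Pointed.Hom.ext
    funext y
    apply (hf U n).1
    obtain ⟨x, rfl⟩ := (hf V n).2 y
    have e : (Equiv.ofBijective _ (hf V n)).symm (evalAt (Hom.app f V) x) = x :=
      (Equiv.ofBijective _ (hf V n)).symm_apply_apply x
    change evalAt (Hom.app f U) (evalAt (M.res h) ((Equiv.ofBijective _ (hf V n)).symm _)) =
      evalAt (Hom.app f U) ((Equiv.ofBijective _ (hf U n)).symm _)
    rw [e, Hom.app_res_apply]
    exact ((Equiv.ofBijective _ (hf U n)).apply_symm_apply _).symm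
  app_act U {m n k} v a y := by
    apply (hf U k).1
    obtain ⟨x, rfl⟩ := (hf U n).2 y
    have e : (Equiv.ofBijective _ (hf U n)).symm (evalAt (Hom.app f U) x) = x :=
      (Equiv.ofBijective _ (hf U n)).symm_apply_apply x
    change evalAt (Hom.app f U) ((Equiv.ofBijective _ (hf U k)).symm _) =
      evalAt (Hom.app f U) ((M.obj U).act a ((Equiv.ofBijective _ (hf U n)).symm _) v)
    rw [e, Hom.app_act]
    exact (Equiv.ofBijective _ (hf U k)).apply_symm_apply _

/-- A morphism that is bijective on sections is an isomorphism. -/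
noncomputable def isoOfBijective (f : M ⟶ N)
    (hf : ∀ (U : Opens X) (n : GammaOp),
      Function.Bijective fun x : (M.obj U).obj n => evalAt (Hom.app f U) x) : M ≅ N where
  hom := f
  inv := inverseOfBijective f hf
  hom_inv_id := hom_ext_apply fun U n x => (Equiv.ofBijective _ (hf U n)).symm_apply_apply x
  inv_hom_id := hom_ext_apply fun U n y => (Equiv.ofBijective _ (hf U n)).apply_symm_apply y

theorem IsSheaf.separated (hF : F.IsSheaf) {U : Opens X} {n : GammaOp} (s t : (F.obj U).obj n)
    (h : ∀ p ∈ U, ∃ (W : Opens X) (hW : W ≤ U), p ∈ W ∧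
      evalAt (F.res hW) s = evalAt (F.res hW) t) : s = t := by
  choose W hW hp e using h
  have hle : (⨆ i : {p // p ∈ U}, W i.1 i.2) ≤ U := iSup_le fun i => hW i.1 i.2
  have hge : U ≤ ⨆ i : {p // p ∈ U}, W i.1 i.2 := fun p hpU =>
    Opens.mem_iSup.2 ⟨⟨p, hpU⟩, hp p hpU⟩
  have key := (hF {p // p ∈ U} (fun i => W i.1 i.2) n
    (fun i => evalAt (F.res (hW i.1 i.2)) s) (fun i j => by
      rw [F.res_res_apply, F.res_res_apply])).unique
    (y₁ := evalAt (F.res hle) s) (y₂ := evalAt (F.res hle) t)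
    (fun i => F.res_res_apply _ _ _)
    (fun i => (F.res_res_apply _ _ _).trans (e i.1 i.2).symm)
  have := congrArg (fun z => evalAt (F.res hge) z) key
  simp only [F.res_res_apply] at this
  rwa [F.res_self_apply, F.res_self_apply] at this

theorem germ_eq_iff {U V : Opens X} {p : X} (hU : p ∈ U) (hV : p ∈ V) {k : GammaOp}
    (s : (M.obj U).obj k) (t : (M.obj V).obj k) :
    (germ hU s : M.Stalk p k) = germ hV t ↔ ∃ (W : Opens X) (hs : W ≤ U) (ht : W ≤ V), p ∈ W ∧
      evalAt (M.res hs) s = evalAt (M.res ht) t :=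
  ⟨fun h => Quotient.exact h, fun h => Quotient.sound h⟩

section LocallyBijective

variable (f : P ⟶ F)

/-- Sections with the same image agree locally. -/
def LocallyInjective : Prop :=
  ∀ (U : Opens X) (k : GammaOp) (s t : (P.obj U).obj k),
    evalAt (Hom.app f U) s = evalAt (Hom.app f U) t →
    ∀ p ∈ U, ∃ (W : Opens X) (h : W ≤ U), p ∈ W ∧ evalAt (P.res h) s = evalAt (P.res h) t

/-- Every section lifts locally. -/
def LocallySurjective : Prop :=
  ∀ (U : Opens X) (k : GammaOp) (t : (F.obj U).obj k),
    ∀ p ∈ U, ∃ (W : Opens X) (h : W ≤ U) (_ : p ∈ W) (u : (P.obj W).obj k),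
      evalAt (Hom.app f W) u = evalAt (F.res h) t

variable {f}

theorem LocallyInjective.germ_eq (hi : LocallyInjective f) {U V W : Opens X} {p : X} (hU : p ∈ U)
    (hV : p ∈ V) (hUW : U ≤ W) (hVW : V ≤ W) {k : GammaOp} (s : (P.obj U).obj k)
    (t : (P.obj V).obj k) (r : (F.obj W).obj k)
    (hs : evalAt (Hom.app f U) s = evalAt (F.res hUW) r)
    (ht : evalAt (Hom.app f V) t = evalAt (F.res hVW) r) :
    (germ hU s : P.Stalk p k) = germ hV t := by
  have e : evalAt (Hom.app f (U ⊓ V)) (evalAt (P.res inf_le_left) s) =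
      evalAt (Hom.app f (U ⊓ V)) (evalAt (P.res inf_le_right) t) := by
    rw [Hom.app_res_apply, Hom.app_res_apply, hs, ht, F.res_res_apply, F.res_res_apply]
  obtain ⟨Z, hZ, hpZ, h⟩ := hi _ _ _ _ e p ⟨hU, hV⟩
  rw [P.res_res_apply, P.res_res_apply] at h
  exact (germ_eq_iff hU hV s t).2 ⟨Z, _, _, hpZ, h⟩

theorem LocallySurjective.exists_germ (hs : LocallySurjective f) {U : Opens X} {k : GammaOp}
    (t : (F.obj U).obj k) (p : X) (hp : p ∈ U) :
    ∃ (σ : P.Stalk p k) (W : Opens X) (h : W ≤ U) (hpW : p ∈ W) (u : (P.obj W).obj k),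
      evalAt (Hom.app f W) u = evalAt (F.res h) t ∧ σ = germ hpW u := by
  obtain ⟨W, h, hpW, u, hu⟩ := hs U k t p hp
  exact ⟨_, W, h, hpW, u, hu, rfl⟩

/-- The family of germs of the local lifts of a section. -/
noncomputable def liftSections (hi : LocallyInjective f) (hs : LocallySurjective f) {U : Opens X}
    {k : GammaOp} (t : (F.obj U).obj k) : P.ShSections U k where
  val p hp := (hs.exists_germ t p hp).choose
  local_germ p hp := by
    obtain ⟨W, h, hpW, u, hu⟩ := hs U k t p hp
    refine ⟨W, h, hpW, u, fun q hq => ?_⟩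
    obtain ⟨W', h', hq', u', hu', e⟩ := (hs.exists_germ t q (h hq)).choose_spec
    rw [e]
    exact hi.germ_eq hq' hq h' h _ _ t hu' hu

theorem liftSections_eq_iff (hi : LocallyInjective f) (hs : LocallySurjective f) {U : Opens X}
    {k : GammaOp} (t : (F.obj U).obj k) (s : P.ShSections U k) :
    liftSections hi hs t = s ↔ ∀ (p : X) (hp : p ∈ U), ∃ (W : Opens X) (h : W ≤ U) (hpW : p ∈ W)
      (u : (P.obj W).obj k), evalAt (Hom.app f W) u = evalAt (F.res h) t ∧
        s.val p hp = germ hpW u := by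
  constructor
  · rintro rfl p hp
    exact (hs.exists_germ t p hp).choose_spec
  · intro H
    apply ShSections.ext'
    intro p hp
    obtain ⟨W, h, hpW, u, hu, e⟩ := H p hp
    obtain ⟨W', h', hpW', u', hu', e'⟩ := (hs.exists_germ t p hp).choose_spec
    rw [e]
    exact e'.trans (hi.germ_eq hpW' hpW h' h _ _ t hu' hu)

theorem liftSections_val (hi : LocallyInjective f) (hs : LocallySurjective f) {U : Opens X}
    {k : GammaOp} (t : (F.obj U).obj k) (p : X) (hp : p ∈ U) : ∃ (W : Opens X) (h : W ≤ U)
      (hpW : p ∈ W) (u : (P.obj W).obj k), evalAt (Hom.app f W) u = evalAt (F.res h) t ∧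
        (liftSections hi hs t).val p hp = germ hpW u :=
  (liftSections_eq_iff hi hs t _).1 rfl p hp

theorem liftSections_app (hi : LocallyInjective f) (hs : LocallySurjective f) {U : Opens X}
    {k : GammaOp} (u : (P.obj U).obj k) :
    liftSections hi hs (evalAt (Hom.app f U) u) = toSh u :=
  (liftSections_eq_iff hi hs _ _).2 fun _ hp =>
    ⟨U, le_rfl, hp, u, (F.res_self_apply _ _).symm, rfl⟩

/-- The morphism from `F` to the sheaf associated to `P` given by the local lifts. -/
noncomputable def liftHom (hi : LocallyInjective f) (hs : LocallySurjective f) :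
    F ⟶ P.shPresheaf where
  app U :=
    { app := fun k => ⟨fun t => liftSections hi hs t, by
        have h : evalAt (Hom.app f U) ((P.obj U).obj k).point = ((F.obj U).obj k).point :=
          Pointed.Hom.map_point _
        rw [← h]
        exact liftSections_app hi hs _⟩
      naturality := fun k k' g => by
        apply Pointed.Hom.ext
        funext t
        refine (liftSections_eq_iff hi hs ((F.obj U).mp g t)
          ((P.shMod U).mp g (liftSections hi hs t))).2 fun p hp => ?_
        obtain ⟨W, h, hpW, u, hu, e⟩ := liftSections_val hi hs t p hp
        refine ⟨W, h, hpW, (P.obj W).mp g u, ?_, congrArg (P.stalkMap p g) e⟩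
        rw [evalAt_map, hu, evalAt_map] }
  app_res {U V} h := by
    apply NatTrans.ext
    funext k
    apply Pointed.Hom.ext
    funext t
    refine ((liftSections_eq_iff hi hs (evalAt (F.res h) t)
      (evalAt (P.shPresheaf.res h) (liftSections hi hs t : P.ShSections V k))).2
        fun p hp => ?_).symm
    obtain ⟨W, hW, hpW, u, hu, e⟩ := liftSections_val hi hs t p (h hp)
    refine ⟨U ⊓ W, inf_le_left, ⟨hp, hpW⟩, evalAt (P.res inf_le_right) u, ?_, ?_⟩
    · rw [Hom.app_res_apply, hu, F.res_res_apply, F.res_res_apply]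
    · exact e.trans (P.germ_res inf_le_right _ u).symm
  app_act U {m n k} v a t := by
    refine (liftSections_eq_iff hi hs ((F.obj U).act a t v)
      ((P.shMod U).act a (liftSections hi hs t : P.ShSections U n) v)).2 fun p hp => ?_
    obtain ⟨W, h, hpW, u, hu, e⟩ := liftSections_val hi hs t p hp
    refine ⟨W, h, hpW, (P.obj W).act (resAlg O h a) u v, ?_, ?_⟩
    · rw [Hom.app_act, hu, F.res_act]
    · refine (congrArg (fun z => P.stalkAct hp a z v) e).trans ?_
      rw [P.stalkAct_germ hp hpW hpW h le_rfl, P.res_self_apply]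

theorem liftHom_bijective (hi : LocallyInjective f) (hs : LocallySurjective f) (hF : F.IsSheaf)
    (U : Opens X) (k : GammaOp) :
    Function.Bijective fun t : (F.obj U).obj k => evalAt (Hom.app (liftHom hi hs) U) t := by
  constructor
  · intro t t' h
    have h' : liftSections hi hs t = liftSections hi hs t' := h
    refine hF.separated t t' fun p hp => ?_
    obtain ⟨V, hV, hpV, u, hu, e⟩ := liftSections_val hi hs t p hp
    obtain ⟨V', hV', hpV', u', hu', e'⟩ := liftSections_val hi hs t' p hp
    rw [h', e', germ_eq_iff] at e
    obtain ⟨W, h1, h2, hpW, h3⟩ := e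
    refine ⟨W, h2.trans hV, hpW, ?_⟩
    rw [← F.res_res_apply h2 hV, ← F.res_res_apply h1 hV', ← hu, ← hu', ← Hom.app_res_apply,
      ← Hom.app_res_apply, h3]
  · intro s
    choose V hV hpV u hu using fun p : {p // p ∈ U} => ShSections.local_germ s p.1 p.2
    have hle : U ≤ ⨆ i, V i := fun p hp => Opens.mem_iSup.2 ⟨⟨p, hp⟩, hpV ⟨p, hp⟩⟩
    obtain ⟨t, ht, -⟩ := hF {p // p ∈ U} V k (fun i => evalAt (Hom.app f (V i)) (u i)) (by
      intro i j
      refine hF.separated _ _ fun p hp => ?_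
      have e := (hu i p hp.1).symm.trans (hu j p hp.2)
      rw [germ_eq_iff] at e
      obtain ⟨W, h1, h2, hpW, h3⟩ := e
      refine ⟨W, le_inf h1 h2, hpW, ?_⟩
      rw [F.res_res_apply, F.res_res_apply, ← Hom.app_res_apply, ← Hom.app_res_apply, h3])
    refine ⟨evalAt (F.res hle) t, (liftSections_eq_iff hi hs _ s).2 fun p hp => ?_⟩
    refine ⟨V ⟨p, hp⟩, hV _, hpV _, u _, ?_, hu ⟨p, hp⟩ p (hpV _)⟩
    rw [F.res_res_apply]
    exact (ht ⟨p, hp⟩).symm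

/-- A locally bijective morphism to a sheaf identifies it with the associated sheaf. -/
noncomputable def sheafifyIso (hi : LocallyInjective f) (hs : LocallySurjective f)
    (hF : F.IsSheaf) : P.sheafify ≅ (⟨F, hF⟩ : SheafOfSMod O) :=
  ObjectProperty.isoMk _ (isoOfBijective (liftHom hi hs) (liftHom_bijective hi hs hF)).symm

theorem sheafifyIso_toSh (hi : LocallyInjective f) (hs : LocallySurjective f)
    (hF : F.IsSheaf) {U : Opens X} {k : GammaOp} (u : (P.obj U).obj k) :
    evalAt (Hom.app (sheafifyIso hi hs hF).hom.hom U) (toSh u : P.ShSections U k) =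
      evalAt (Hom.app f U) u := by
  rw [← liftSections_app hi hs u]
  exact (Equiv.ofBijective _ (liftHom_bijective hi hs hF U k)).symm_apply_apply _

end LocallyBijective

end PresheafOfSMod

/-! ## Local generators of `O(D)` -/

/-- The complement of `∞`. -/
def finitePart : Opens SpecZBar :=
  ⟨{x | x ≠ SpecZPt.infty}, Or.inr ⟨by simp, (Set.finite_singleton SpecZPt.infty).subset
    fun x hx => by simpa using hx⟩⟩

/-- The complement of the support of a divisor on `Spec ℤ`. -/
def offSupport (D : FinDivisor) : Opens SpecZBar :=
  ⟨{x | ∀ p, x = SpecZPt.prime p → D p = 0}, Or.inr ⟨by simp,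
    (D.hasFiniteSupport.image SpecZPt.prime).subset fun x hx => by
      simp only [Set.mem_compl_iff, Set.mem_ofPred_eq, not_forall] at hx
      obtain ⟨p, rfl, hp⟩ := hx
      exact ⟨p, hp, rfl⟩⟩⟩

theorem mem_finitePart {x : SpecZPt} : x ∈ finitePart ↔ x ≠ SpecZPt.infty := Iff.rfl

theorem prime_mem_offSupport {D : FinDivisor} {p : Nat.Primes} :
    SpecZPt.prime p ∈ offSupport D ↔ D p = 0 :=
  ⟨fun h => h p rfl, fun h q hq => by cases hq; exact h⟩

theorem infty_mem_offSupport (D : FinDivisor) : SpecZPt.infty ∈ offSupport D :=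
  fun _ h => by cases h

theorem generic_mem_offSupport (D : FinDivisor) : SpecZPt.generic ∈ offSupport D :=
  fun _ h => by cases h

theorem ne_bot_of_mem {U : Opens SpecZBar} {x : SpecZPt} (h : x ∈ U) : U ≠ ⊥ := by
  rintro rfl
  exact h

/-- The rational number `r > 0` generates `O(D)` over `W ∩ Spec ℤ`. -/
structure IsGenerator (D : FinDivisor) (W : Opens SpecZBar) (r : ℚ) : Prop where
  ne_bot : W ≠ ⊥
  pos : 0 < r
  val : ∀ p : Nat.Primes, SpecZPt.prime p ∈ W → padicValRat p r + D p = 0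

theorem IsGenerator.mem {D : FinDivisor} {W : Opens SpecZBar} {r : ℚ} (h : IsGenerator D W r) :
    r ∈ finSections D W :=
  ⟨fun p hp => Or.inr (h.val p hp).ge, fun h' => absurd h' h.ne_bot⟩

theorem IsGenerator.inv_mem {D : FinDivisor} {W : Opens SpecZBar} {r : ℚ}
    (h : IsGenerator D W r) : r⁻¹ ∈ finSections (-D) W :=
  ⟨fun p hp => Or.inr (by
    have : Fact (p : ℕ).Prime := ⟨p.2⟩
    have := h.val p hp
    rw [padicValRat.inv, Finsupp.neg_apply]
    omega), fun h' => absurd h' h.ne_bot⟩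

theorem IsGenerator.div_mem {D D' D'' : FinDivisor} (hD : D'' = D + D') {W : Opens SpecZBar}
    {r q : ℚ} (h : IsGenerator D W r) (hq : q ∈ finSections D'' W) :
    q * r⁻¹ ∈ finSections D' W := by
  have := finSections_mul hq h.inv_mem
  rwa [hD, add_assoc, add_comm D', ← add_assoc, add_neg_cancel, zero_add] at this

theorem isGenerator_inf_offSupport (D : FinDivisor) {U : Opens SpecZBar} (hU : U ≠ ⊥) {r : ℚ}
    (hr : 0 < r) :
    IsGenerator D (U ⊓ offSupport (principalFin (Units.mk0 r hr.ne') + D)) r where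
  ne_bot := ne_bot_of_mem (x := SpecZPt.generic) ⟨generic_mem hU, generic_mem_offSupport _⟩
  pos := hr
  val _ hp := prime_mem_offSupport.1 hp.2

/-- Near each point there is a generator of `O(D)`, which can be prescribed at `∞`. -/
theorem exists_isGenerator (D : FinDivisor) {U : Opens SpecZBar} {x : SpecZPt} (hx : x ∈ U)
    {s : ℚ} (hs : 0 < s) : ∃ W ≤ U, x ∈ W ∧ ∃ r, IsGenerator D W r ∧
      (SpecZPt.infty ∈ W → r = s) := by
  cases x with
  | infty =>
    exact ⟨_, inf_le_left, ⟨hx, infty_mem_offSupport _⟩, s,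
      isGenerator_inf_offSupport D (ne_bot_of_mem hx) hs, fun _ => rfl⟩
  | generic =>
    have h : SpecZPt.generic ∈ U ⊓ finitePart := ⟨hx, mem_finitePart.2 (by simp)⟩
    exact ⟨_, inf_le_left.trans inf_le_left, ⟨h, generic_mem_offSupport _⟩, 1,
      isGenerator_inf_offSupport D (ne_bot_of_mem h) one_pos, fun h => absurd rfl h.1.2⟩
  | prime p =>
    have : Fact (p : ℕ).Prime := ⟨p.2⟩
    have h : SpecZPt.prime p ∈ U ⊓ finitePart := ⟨hx, mem_finitePart.2 (by simp)⟩
    have hr : (0 : ℚ) < (p : ℚ) ^ (-D p) := zpow_pos (by exact_mod_cast p.2.pos) _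
    refine ⟨_, inf_le_left.trans inf_le_left, ⟨h, prime_mem_offSupport.2 ?_⟩, _,
      isGenerator_inf_offSupport D (ne_bot_of_mem h) hr, fun h => absurd rfl h.1.2⟩
    change padicValRat p ((p : ℚ) ^ (-D p)) + D p = 0
    rw [padicValRat.zpow, padicValRat.self p.2.one_lt]
    ring

/-! ## The product morphisms -/

/-- The sum `∑ |φ(i)|` as a rational number. -/
def sumAbsRat {n : GammaOp} (φ : Fin n.card → ℚ) : ℚ := ∑ i, |φ i|

theorem coe_sumAbsRat {n : GammaOp} (φ : Fin n.card → ℚ) : (sumAbsRat φ : ℝ) = sumAbs φ := by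
  simp [sumAbsRat, sumAbs]

theorem sumAbsRat_nonneg {n : GammaOp} (φ : Fin n.card → ℚ) : 0 ≤ sumAbsRat φ :=
  Finset.sum_nonneg fun _ _ => abs_nonneg _

theorem sumAbsRat_mul {n : GammaOp} (φ : Fin n.card → ℚ) {r : ℚ} (hr : 0 ≤ r) :
    sumAbsRat (n := n) (fun i => φ i * r) = sumAbsRat φ * r := by
  simp [sumAbsRat, abs_mul, abs_of_nonneg hr, Finset.sum_mul]

/-- `1₊ ∧ k₊ ≃ k₊`. -/
def SmashMap.leftUnit (k : GammaOp) : SmashMap ⟨1⟩ k k where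
  toFun x y := x.bind fun _ => y
  left_none _ := rfl
  right_none x := by cases x <;> rfl

theorem prod_const_leftUnit (r : ℚ) {k : GammaOp} (ψ : Fin k.card → ℚ) :
    prod (m := ⟨1⟩) (fun _ => r) ψ (SmashMap.leftUnit k) = fun i => r * ψ i := by
  funext l
  simp [prod, SmashMap.leftUnit]

/-- On nonnegative rational numbers, the third bound consists of the products of elements of the
first two. -/
structure IsProductBound (B B' B'' : LowerSet ℝ) : Prop where
  mul : ∀ s t : ℚ, 0 ≤ s → 0 ≤ t → (s : ℝ) ∈ B → (t : ℝ) ∈ B' → ((s * t : ℚ) : ℝ) ∈ B''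
  split : ∀ t : ℚ, 0 ≤ t → (t : ℝ) ∈ B'' →
    ∃ r : ℚ, 0 < r ∧ (r : ℝ) ∈ B ∧ ((t * r⁻¹ : ℚ) : ℝ) ∈ B'

section Product

variable {D D' D'' : FinDivisor} {B B' B'' : LowerSet ℝ}

/-- The product of sections. -/
def NormSec.mul (hD : D'' = D + D') (h : IsProductBound B B' B'') {U : Opens SpecZBar}
    {m n k : GammaOp} (x : NormSec D B U m) (y : NormSec D' B' U n) (v : SmashMap m n k) :
    NormSec D'' B'' U k where
  val := prod x.val y.val v
  mem l := sum_mem fun i _ => sum_mem fun j _ => by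
    split_ifs
    · rw [hD]
      exact finSections_mul (x.mem i) (y.mem j)
    · exact zero_mem _
  bound hU := B''.lower ((sumAbs_prod_le v x.val y.val).trans_eq (by
      rw [← coe_sumAbsRat, ← coe_sumAbsRat, Rat.cast_mul]))
    (h.mul _ _ (sumAbsRat_nonneg _) (sumAbsRat_nonneg _)
      (by rw [coe_sumAbsRat]; exact x.bound hU) (by rw [coe_sumAbsRat]; exact y.bound hU))

variable (hB : (0 : ℝ) ∈ B) (hB' : (0 : ℝ) ∈ B') (hB'' : (0 : ℝ) ∈ B'')

theorem prod_zero_left {m n k : GammaOp} (ψ : Fin n.card → ℚ) (v : SmashMap m n k) :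
    prod (fun _ => 0) ψ v = fun _ => 0 := by
  funext l; simp [prod]

theorem prod_zero_right {m n k : GammaOp} (φ : Fin m.card → ℚ) (v : SmashMap m n k) :
    prod φ (fun _ => 0) v = fun _ => 0 := by
  funext l; simp [prod]

/-- The product on the sections of the smash product presheaf. -/
def smashProd (hD : D'' = D + D') (h : IsProductBound B B' B'') (U : Opens SpecZBar)
    (k : GammaOp) :
    SmashObj ((normPresheaf D B hB).obj U) ((normPresheaf D' B' hB').obj U) k →
      NormSec D'' B'' U k :=
  Quot.lift (fun t => NormSec.mul hD h (t.x : NormSec D B U t.m) (t.y : NormSec D' B' U t.n) t.v)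
    (by
      rintro _ _ (⟨f, g, x, y, v⟩ | ⟨x, y, v, x', y', v', h1, h2⟩ | ⟨a, x, y, r, w, s, w', e⟩)
      · exact NormSec.ext (prod_push f g v _ _).symm
      · have key : ∀ {m n : GammaOp} (x : NormSec D B U m) (y : NormSec D' B' U n)
            (v : SmashMap m n k),
            (x = (((normPresheaf D B hB).obj U).obj m).point ∨
              y = (((normPresheaf D' B' hB').obj U).obj n).point) →
            prod x.val y.val v = fun _ => 0 := by
          rintro m n x y v (rfl | rfl)
          · exact prod_zero_left _ _
          · exact prod_zero_right _ _
        exact NormSec.ext ((key x y v h1).trans (key x' y' v' h2).symm)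
      · refine NormSec.ext ?_
        change prod (prod (NormSec.val a) (NormSec.val x) r) (NormSec.val y) w =
          prod (NormSec.val x) (prod (NormSec.val a) (NormSec.val y) s) w'
        rw [prod_comm r]
        exact prod_assoc r.swap w s w' (fun i c j => e c i j) _ _ _)

/-- The morphism from the smash product presheaf induced by the product of `ℚ`. -/
noncomputable def prodHom (hD : D'' = D + D') (h : IsProductBound B B' B'') :
    (normPresheaf D B hB).smash (normPresheaf D' B' hB') ⟶ normPresheaf D'' B'' hB'' where
  app U :=
    { app := fun k => ⟨smashProd hB hB' hD h U k, NormSec.ext (prod_zero_left _ _)⟩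
      naturality := fun k k' f => by
        apply Pointed.Hom.ext
        funext t
        obtain ⟨x, y, v⟩ := t
        exact NormSec.ext (push_prod v f _ _).symm }
  app_res {U V} hUV := by
    apply NatTrans.ext
    funext k
    apply Pointed.Hom.ext
    funext t
    obtain ⟨x, y, v⟩ := t
    exact NormSec.ext (prod_mul _ (unitSec_mul_unitSec le_rfl) v _ _).symm
  app_act U {l n k} w a t := by
    obtain ⟨x, y, v⟩ := t
    rename_i m n'
    refine NormSec.ext ?_
    change prod (prod (NormSec.val a) (NormSec.val x) (SmashMap.univ l m)) (NormSec.val y)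
      (w.assoc v) = prod (NormSec.val a) (prod (NormSec.val x) (NormSec.val y) v) w
    exact prod_assoc _ _ _ _ (SmashMap.assoc_univ w v) _ _ _

/-- A generator as a section. -/
def IsGenerator.sec {W : Opens SpecZBar} {r : ℚ} (hr : IsGenerator D W r)
    (hrB : SpecZPt.infty ∈ W → (r : ℝ) ∈ B) : NormSec D B W ⟨1⟩ where
  val _ := r
  mem _ := hr.mem
  bound h := by
    have : |(r : ℝ)| = r := abs_of_pos (by exact_mod_cast hr.pos)
    simpa [sumAbs, this] using hrB h

/-- The quotient of a section by a generator. -/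
def IsGenerator.divSec (hD : D'' = D + D') {W : Opens SpecZBar} {r : ℚ} (hr : IsGenerator D W r)
    {k : GammaOp} (t : NormSec D'' B'' W k)
    (ht : SpecZPt.infty ∈ W → ((sumAbsRat t.val * r⁻¹ : ℚ) : ℝ) ∈ B') : NormSec D' B' W k where
  val i := t.val i * r⁻¹
  mem i := hr.div_mem hD (t.mem i)
  bound h := by
    rw [← coe_sumAbsRat, sumAbsRat_mul _ (inv_nonneg.2 hr.pos.le)]
    exact ht h

/-- Sections of the smash product are of the form `r ∧ z`, for a suitable generator `r`. -/
theorem smashMk_eq_of_isGenerator {W : Opens SpecZBar} {r : ℚ} (hr : IsGenerator D W r)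
    (hrB : SpecZPt.infty ∈ W → (r : ℝ) ∈ B) {m n k : GammaOp} (x : NormSec D B W m)
    (hx : SpecZPt.infty ∈ W → sumAbsRat x.val ≤ r)
    (y : NormSec D' B' W n) (v : SmashMap m n k) :
    ∃ z : NormSec D' B' W k, (∀ i, z.val i = prod x.val y.val v i * r⁻¹) ∧
      (smashMk (M := (normPresheaf D B hB).obj W) (N := (normPresheaf D' B' hB').obj W) x y v) =
        smashMk (M := (normPresheaf D B hB).obj W) (N := (normPresheaf D' B' hB').obj W)
          (hr.sec hrB : NormSec D B W ⟨1⟩) z (SmashMap.leftUnit k) := by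
  let a : NormSec 0 (LowerSet.Iic 1) W m := hr.divSec (add_zero D).symm x fun h => by
    rw [LowerSet.mem_Iic_iff]
    have : sumAbsRat x.val * r⁻¹ ≤ 1 := by
      rw [← div_eq_mul_inv]
      exact div_le_one_of_le₀ (hx h) hr.pos.le
    exact_mod_cast this
  refine ⟨normMul a y v, fun i => ?_, ?_⟩
  · change prod (fun i => x.val i * r⁻¹) y.val v i = _
    simp only [prod, Finset.sum_mul]
    refine Finset.sum_congr rfl fun i _ => Finset.sum_congr rfl fun j _ => ?_
    split_ifs <;> ring
  · have hxa : x = normMul a (hr.sec hrB : NormSec D B W ⟨1⟩) (SmashMap.leftUnit m).swap := by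
      refine NormSec.ext ?_
      change x.val = prod a.val (fun _ => r) (SmashMap.leftUnit m).swap
      rw [prod_comm]
      change _ = prod (fun _ => r) a.val (SmashMap.leftUnit m)
      rw [prod_const_leftUnit]
      funext i
      change x.val i = r * (x.val i * r⁻¹)
      have := hr.pos.ne'
      field_simp
    nth_rw 1 [hxa]
    exact Quot.sound (SmashRel.balance (M := (normPresheaf D B hB).obj W)
      (N := (normPresheaf D' B' hB').obj W) a (hr.sec hrB : NormSec D B W ⟨1⟩) y
      (SmashMap.leftUnit m).swap v v (SmashMap.leftUnit k) fun c i j => by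
        cases i with
        | none => exact v.left_none j
        | some i => rfl)

theorem prodHom_locallyInjective (hD : D'' = D + D') (h : IsProductBound B B' B'') :
    PresheafOfSMod.LocallyInjective (prodHom hB hB' hB'' hD h) := by
  intro U k s t hst q hq
  obtain ⟨x₁, y₁, v₁⟩ := s
  obtain ⟨x₂, y₂, v₂⟩ := t
  have hr : ∃ r : ℚ, 0 < r ∧ (SpecZPt.infty ∈ U → (r : ℝ) ∈ B ∧
      sumAbsRat (NormSec.val x₁) ≤ r ∧ sumAbsRat (NormSec.val x₂) ≤ r) := by
    obtain ⟨r, hr, hrB, -⟩ := h.split 0 le_rfl (by simpa using hB'')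
    refine ⟨max r (max (sumAbsRat (NormSec.val x₁)) (sumAbsRat (NormSec.val x₂))),
      lt_max_of_lt_left hr, fun hU => ⟨?_, by simp, by simp⟩⟩
    have h₁ : ((sumAbsRat (NormSec.val x₁) : ℚ) : ℝ) ∈ B := by
      rw [coe_sumAbsRat]; exact NormSec.bound x₁ hU
    have h₂ : ((sumAbsRat (NormSec.val x₂) : ℚ) : ℝ) ∈ B := by
      rw [coe_sumAbsRat]; exact NormSec.bound x₂ hU
    rcases max_choice r (max (sumAbsRat (NormSec.val x₁)) (sumAbsRat (NormSec.val x₂)))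
      with e | e
    · rwa [e]
    · rw [e]
      rcases max_choice (sumAbsRat (NormSec.val x₁)) (sumAbsRat (NormSec.val x₂)) with e | e <;>
        rwa [e]
  obtain ⟨s, hs, hsU⟩ := hr
  obtain ⟨W, hW, hqW, r, hr, hrs⟩ := exists_isGenerator D hq hs
  have hrB : SpecZPt.infty ∈ W → (r : ℝ) ∈ B := fun hi => by
    rw [hrs hi]; exact (hsU (hW hi)).1
  refine ⟨W, hW, hqW, ?_⟩
  have hle : ∀ {m : GammaOp} (x : NormSec D B U m), sumAbsRat x.val ≤ s →
      SpecZPt.infty ∈ W → sumAbsRat (normRes hW x).val ≤ r := fun x hx hi => by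
    rw [hrs hi]
    refine le_trans ?_ hx
    have := sumAbs_mul_le _ (abs_unitSec_le W) x.val
    rw [← coe_sumAbsRat, ← coe_sumAbsRat] at this
    exact_mod_cast this
  obtain ⟨z₁, hz₁, e₁⟩ := smashMk_eq_of_isGenerator hB hB' hr hrB (normRes hW x₁)
    (fun hi => hle x₁ (hsU (hW hi)).2.1 hi) (normRes hW y₁) v₁
  obtain ⟨z₂, hz₂, e₂⟩ := smashMk_eq_of_isGenerator hB hB' hr hrB (normRes hW x₂)
    (fun hi => hle x₂ (hsU (hW hi)).2.2 hi) (normRes hW y₂) v₂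
  have hz : z₁ = z₂ := by
    refine NormSec.ext (funext fun i => ?_)
    have hst' : prod (NormSec.val x₁) (NormSec.val y₁) v₁ =
        prod (NormSec.val x₂) (NormSec.val y₂) v₂ := congrArg NormSec.val hst
    rw [hz₁, hz₂]
    simp only [normRes]
    rw [prod_mul _ (unitSec_mul_unitSec le_rfl), prod_mul _ (unitSec_mul_unitSec le_rfl), hst']
  exact e₁.trans (hz ▸ e₂.symm)

theorem prodHom_locallySurjective (hD : D'' = D + D') (h : IsProductBound B B' B'') :
    PresheafOfSMod.LocallySurjective (prodHom hB hB' hB'' hD h) := by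
  intro U k t q hq
  have hr : ∃ r : ℚ, 0 < r ∧ (SpecZPt.infty ∈ U → (r : ℝ) ∈ B ∧
      ((sumAbsRat (NormSec.val t) * r⁻¹ : ℚ) : ℝ) ∈ B') := by
    by_cases hU : SpecZPt.infty ∈ U
    · obtain ⟨r, h0, h1, h2⟩ := h.split _ (sumAbsRat_nonneg (NormSec.val t)) (by
        rw [coe_sumAbsRat]; exact NormSec.bound t hU)
      exact ⟨r, h0, fun _ => ⟨h1, h2⟩⟩
    · exact ⟨1, one_pos, fun h => absurd h hU⟩
  obtain ⟨s, hs, hsU⟩ := hr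
  obtain ⟨W, hW, hqW, r, hr, hrs⟩ := exists_isGenerator D hq hs
  have hval : (normRes hW (t : NormSec D'' B'' U k)).val = NormSec.val t := by
    funext i
    change unitSec W * _ = _
    rw [unitSec_of_ne hr.ne_bot, one_mul]
  let z : NormSec D' B' W k := hr.divSec hD (normRes hW (t : NormSec D'' B'' U k)) fun hi => by
    rw [hval, hrs hi]; exact (hsU (hW hi)).2
  refine ⟨W, hW, hqW, smashMk (M := (normPresheaf D B hB).obj W)
    (N := (normPresheaf D' B' hB').obj W) (hr.sec fun hi => by
      rw [hrs hi]; exact (hsU (hW hi)).1 : NormSec D B W ⟨1⟩) z (SmashMap.leftUnit k), ?_⟩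
  refine NormSec.ext ?_
  change prod (fun _ => r) z.val (SmashMap.leftUnit k) =
    (normRes hW (t : NormSec D'' B'' U k)).val
  rw [prod_const_leftUnit]
  funext i
  change r * ((normRes hW (t : NormSec D'' B'' U k)).val i * r⁻¹) = _
  have := hr.pos.ne'
  field_simp

/-- The isomorphism from the smash product to the sheaf of the product bound. -/
noncomputable def smashIso (hD : D'' = D + D') (h : IsProductBound B B' B'') :
    SheafOfSMod.smash (normSheaf D B hB) (normSheaf D' B' hB') ≅ normSheaf D'' B'' hB'' :=
  PresheafOfSMod.sheafifyIso (prodHom_locallyInjective hB hB' hB'' hD h)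
    (prodHom_locallySurjective hB hB' hB'' hD h) (normPresheaf_isSheaf D'' B'' hB'')

theorem smashIso_smashSec (hD : D'' = D + D') (h : IsProductBound B B' B'') {U : Opens SpecZBar}
    {m n k : GammaOp} (x : NormSec D B U m) (y : NormSec D' B' U n) (v : SmashMap m n k) :
    evalAt (PresheafOfSMod.Hom.app (smashIso hB hB' hB'' hD h).hom.hom U)
      (SheafOfSMod.smashSec (M := normSheaf D B hB) (N := normSheaf D' B' hB') x y v) =
        NormSec.mul hD h x y v :=
  PresheafOfSMod.sheafifyIso_toSh (prodHom_locallyInjective hB hB' hB'' hD h)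
    (prodHom_locallySurjective hB hB' hB'' hD h) (normPresheaf_isSheaf D'' B'' hB'')
    (smashMk (M := (normPresheaf D B hB).obj U) (N := (normPresheaf D' B' hB').obj U) x y v :
      (((normPresheaf D B hB).smash (normPresheaf D' B' hB')).obj U).obj k)

end Product

/-! ## Morphisms between the sheaves of a divisor with a norm bound -/

section Scalar

variable {D D' : FinDivisor} {B B' : LowerSet ℝ} {hB : (0 : ℝ) ∈ B} {hB' : (0 : ℝ) ∈ B'}

theorem intCast_mem_finSections (z : ℤ) {U : Opens SpecZBar} (hU : U ≠ ⊥) :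
    (z : ℚ) ∈ finSections 0 U :=
  ⟨fun p _ => Or.inr (by simp), fun h => absurd h hU⟩

/-- An integer as a section of the structure sheaf away from `∞`. -/
def intSec (z : ℤ) {U : Opens SpecZBar} (hU : U ≠ ⊥) (hi : SpecZPt.infty ∉ U) :
    NormSec 0 (LowerSet.Iic 1) U ⟨1⟩ where
  val _ := z
  mem _ := intCast_mem_finSections z hU
  bound h := absurd h hi

/-- The projection `k₊ → 1₊` to the `i`-th coordinate. -/
def coordMap {k : GammaOp} (i : Fin k.card) : k ⟶ (⟨1⟩ : GammaOp) :=
  ⟨fun y => if y = some i then some 0 else none, by simp⟩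

theorem push_coordMap {k : GammaOp} (i : Fin k.card) (φ : Fin k.card → ℚ) (j : Fin 1) :
    push (coordMap i) φ j = φ i := by
  have : j = 0 := Subsingleton.elim _ _
  subst this
  have h : ∀ l, ((coordMap i).toFun (some l) = some 0) ↔ l = i := by
    intro l
    simp [coordMap]
  simp [push, h]

/-- Morphisms of sheaves of modules are given by the multiplication with a rational number. -/
theorem exists_scalar (f : normPresheaf D B hB ⟶ normPresheaf D' B' hB') :
    ∃ c : ℚ, ∀ (U : Opens SpecZBar) (k : GammaOp) (x : NormSec D B U k) (i : Fin k.card),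
      NormSec.val (evalAt (PresheafOfSMod.Hom.app f U) (x : ((normPresheaf D B hB).obj U).obj k)) i
        = c * x.val i := by
  have hV : IsGenerator D (finitePart ⊓ offSupport D) 1 :=
    { ne_bot := ne_bot_of_mem (x := SpecZPt.generic)
        ⟨mem_finitePart.2 (by simp), generic_mem_offSupport _⟩
      pos := one_pos
      val := fun p hp => by simpa using prime_mem_offSupport.1 hp.2 }
  let o : NormSec D B (finitePart ⊓ offSupport D) ⟨1⟩ := hV.sec fun h => absurd rfl h.1
  let fo : NormSec D' B' (finitePart ⊓ offSupport D) ⟨1⟩ :=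
    evalAt (PresheafOfSMod.Hom.app f _) (o : ((normPresheaf D B hB).obj _).obj ⟨1⟩)
  have h1 : ∀ (U : Opens SpecZBar) (x : NormSec D B U ⟨1⟩),
      NormSec.val (evalAt (PresheafOfSMod.Hom.app f U)
        (x : ((normPresheaf D B hB).obj U).obj ⟨1⟩)) 0 = fo.val 0 * x.val 0 := by
    intro U x
    by_cases hU : U = ⊥
    · rw [(x.mem 0).2 hU, (NormSec.mem (evalAt (PresheafOfSMod.Hom.app f U)
        (x : ((normPresheaf D B hB).obj U).obj ⟨1⟩)) 0).2 hU, mul_zero]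
    have hWU : U ⊓ (finitePart ⊓ offSupport D) ≤ U := inf_le_left
    have hWV : U ⊓ (finitePart ⊓ offSupport D) ≤ finitePart ⊓ offSupport D := inf_le_right
    have hW : U ⊓ (finitePart ⊓ offSupport D) ≠ ⊥ := ne_bot_of_mem (x := SpecZPt.generic)
      ⟨generic_mem hU, generic_mem hV.ne_bot⟩
    have hi : SpecZPt.infty ∉ U ⊓ (finitePart ⊓ offSupport D) := fun h => h.2.1 rfl
    have e : normMul (intSec (x.val 0).num hW hi) (normRes hWV o) (SmashMap.leftUnit ⟨1⟩) =
        normMul (intSec (x.val 0).den hW hi) (normRes hWU x) (SmashMap.leftUnit ⟨1⟩) := by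
      refine NormSec.ext ?_
      change prod (fun _ => ((x.val 0).num : ℚ)) _ _ =
        prod (fun _ => (((x.val 0).den : ℤ) : ℚ)) _ _
      rw [prod_const_leftUnit, prod_const_leftUnit]
      funext i
      have hi0 : i = 0 := Subsingleton.elim (α := Fin 1) _ _
      subst hi0
      change ((x.val 0).num : ℚ) * (unitSec _ * 1) =
        (((x.val 0).den : ℤ) : ℚ) * (unitSec _ * x.val 0)
      rw [unitSec_of_ne hW, one_mul, one_mul, mul_one, Int.cast_natCast, mul_comm,
        Rat.mul_den_eq_num]
    have hact : ∀ (z : ℤ) {V : Opens SpecZBar} (h : U ⊓ (finitePart ⊓ offSupport D) ≤ V)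
        (y : NormSec D B V ⟨1⟩),
        NormSec.val (evalAt (PresheafOfSMod.Hom.app f (U ⊓ (finitePart ⊓ offSupport D)))
          (normMul (intSec z hW hi) (normRes h y) (SmashMap.leftUnit ⟨1⟩) :
            ((normPresheaf D B hB).obj _).obj ⟨1⟩)) 0 =
          z * NormSec.val (evalAt (PresheafOfSMod.Hom.app f V)
            (y : ((normPresheaf D B hB).obj V).obj ⟨1⟩)) 0 := by
      intro z V h y
      have e1 := PresheafOfSMod.Hom.app_act f (U ⊓ (finitePart ⊓ offSupport D))
        (SmashMap.leftUnit ⟨1⟩) (intSec z hW hi) (normRes h y)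
      have e2 := PresheafOfSMod.Hom.app_res_apply f h
        (y : ((normPresheaf D B hB).obj V).obj ⟨1⟩)
      have e3 := congrFun (congrArg NormSec.val e1) 0
      refine e3.trans ?_
      change prod (fun _ => (z : ℚ)) (NormSec.val (evalAt (PresheafOfSMod.Hom.app f _)
        (normRes h y : ((normPresheaf D B hB).obj _).obj ⟨1⟩))) (SmashMap.leftUnit ⟨1⟩) 0 = _
      rw [prod_const_leftUnit]
      have e4 := congrFun (congrArg NormSec.val e2) 0
      refine congrArg (fun t => (z : ℚ) * t) (e4.trans ?_)
      change unitSec _ * _ = _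
      rw [unitSec_of_ne hW, one_mul]
    have e' := (hact (x.val 0).num hWV o).symm.trans
      ((congrArg (fun s : NormSec D B (U ⊓ (finitePart ⊓ offSupport D)) ⟨1⟩ =>
        NormSec.val (evalAt (PresheafOfSMod.Hom.app f (U ⊓ (finitePart ⊓ offSupport D)))
          (s : ((normPresheaf D B hB).obj _).obj ⟨1⟩)) 0) e).trans
        (hact (x.val 0).den hWU x))
    change ((x.val 0).num : ℚ) * fo.val 0 = _ at e'
    rw [Int.cast_natCast, ← Rat.mul_den_eq_num] at e'
    have hden : ((x.val 0).den : ℚ) ≠ 0 := by exact_mod_cast (x.val 0).den_nz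
    apply mul_left_cancel₀ hden
    rw [← e']
    ring
  refine ⟨fo.val 0, fun U k x i => ?_⟩
  have e := evalAt_map (PresheafOfSMod.Hom.app f U) (coordMap i)
    (x : ((normPresheaf D B hB).obj U).obj k)
  have e' := congrFun (congrArg NormSec.val e) 0
  have e2 := h1 U (((normPresheaf D B hB).obj U).mp (coordMap i) x)
  change _ = push (coordMap i) _ 0 at e'
  rw [push_coordMap] at e'
  rw [← e']
  refine e2.trans ?_
  change _ * push (coordMap i) x.val 0 = _
  rw [push_coordMap]

theorem le_of_scalar (f : normPresheaf D B hB ⟶ normPresheaf D' B' hB') {c : ℚ} (hc : c ≠ 0)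
    (hf : ∀ (U : Opens SpecZBar) (k : GammaOp) (x : NormSec D B U k) (i : Fin k.card),
      NormSec.val (evalAt (PresheafOfSMod.Hom.app f U) (x : ((normPresheaf D B hB).obj U).obj k)) i
        = c * x.val i) (p : Nat.Primes) : D p ≤ D' p + padicValRat p c := by
  have : Fact (p : ℕ).Prime := ⟨p.2⟩
  obtain ⟨W, hW, hp, r, hr, -⟩ := exists_isGenerator D
    (mem_finitePart.2 (by simp) : SpecZPt.prime p ∈ finitePart) one_pos
  have hi : SpecZPt.infty ∉ W := fun h => hW h rfl
  have h := NormSec.mem (evalAt (PresheafOfSMod.Hom.app f W)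
    (hr.sec fun h => absurd h hi : NormSec D B W ⟨1⟩)) 0
  rw [hf] at h
  change c * r ∈ _ at h
  have h' := (h.1 p hp).resolve_left (mul_ne_zero hc hr.pos.ne')
  rw [padicValRat.mul hc hr.pos.ne'] at h'
  have := hr.val p hp
  omega

theorem bound_of_scalar (f : normPresheaf D B hB ⟶ normPresheaf D' B' hB') {c : ℚ}
    (hf : ∀ (U : Opens SpecZBar) (k : GammaOp) (x : NormSec D B U k) (i : Fin k.card),
      NormSec.val (evalAt (PresheafOfSMod.Hom.app f U) (x : ((normPresheaf D B hB).obj U).obj k)) i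
        = c * x.val i) {r : ℚ} (hr : 0 < r) (hrB : (r : ℝ) ∈ B) :
    ((|c| * r : ℚ) : ℝ) ∈ B' := by
  obtain ⟨W, hW, hi, s, hs, hsr⟩ := exists_isGenerator D
    (Opens.mem_top (α := SpecZBar) SpecZPt.infty) hr
  obtain rfl := hsr hi
  have h := NormSec.bound (evalAt (PresheafOfSMod.Hom.app f W)
    (hs.sec fun _ => hrB : NormSec D B W ⟨1⟩)) hi
  rw [← coe_sumAbsRat] at h
  convert h using 2
  simp only [sumAbsRat, hf]
  simp [IsGenerator.sec, abs_mul, abs_of_pos hr]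

theorem exists_scalar_of_iso (e : normSheaf D B hB ≅ normSheaf D' B' hB') :
    ∃ c : ℚ, c ≠ 0 ∧ (∀ p : Nat.Primes, D p = D' p + padicValRat p c) ∧
      ∀ r : ℚ, 0 < r → ((r : ℝ) ∈ B ↔ ((|c| * r : ℚ) : ℝ) ∈ B') := by
  obtain ⟨c, hc⟩ := exists_scalar (D := D) (D' := D') (hB := hB) (hB' := hB') e.hom.hom
  obtain ⟨c', hc'⟩ := exists_scalar (D := D') (D' := D) (hB := hB') (hB' := hB) e.inv.hom
  have hcc : c' * c = 1 := by
    obtain ⟨W, hW, hx, r, hr, -⟩ := exists_isGenerator D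
      (mem_finitePart.2 (by simp) : SpecZPt.generic ∈ finitePart) one_pos
    have hi : SpecZPt.infty ∉ W := fun h => hW h rfl
    let s : NormSec D B W ⟨1⟩ := hr.sec fun h => absurd h hi
    have h1 := hc' W ⟨1⟩ (evalAt (PresheafOfSMod.Hom.app e.hom.hom W)
      (s : ((normPresheaf D B hB).obj W).obj ⟨1⟩)) 0
    rw [hc W ⟨1⟩ s 0] at h1
    have h2 : evalAt (PresheafOfSMod.Hom.app (e.hom ≫ e.inv).hom W)
        (s : ((normPresheaf D B hB).obj W).obj ⟨1⟩) = s := by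
      rw [e.hom_inv_id]; rfl
    have h3 : s.val 0 = c' * (c * s.val 0) := (congrFun (congrArg NormSec.val h2) 0).symm.trans h1
    have h4 : s.val 0 ≠ 0 := hr.pos.ne'
    apply mul_right_cancel₀ h4
    rw [one_mul, mul_assoc, ← h3]
  have hc0 : c ≠ 0 := right_ne_zero_of_mul_eq_one hcc
  obtain rfl : c' = c⁻¹ := eq_inv_of_mul_eq_one_left hcc
  refine ⟨c, hc0, fun p => ?_, fun r hr => ⟨bound_of_scalar _ hc hr, fun h => ?_⟩⟩
  · have : Fact (p : ℕ).Prime := ⟨p.2⟩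
    have h1 := le_of_scalar _ hc0 hc p
    have h2 := le_of_scalar _ (inv_ne_zero hc0) hc' p
    rw [padicValRat.inv] at h2
    omega
  · have h' := bound_of_scalar _ hc' (mul_pos (abs_pos.2 hc0) hr) h
    rwa [abs_inv, inv_mul_cancel_left₀ (abs_pos.2 hc0).ne'] at h'

theorem mul_mem_finSections {c : ℚ} (hc : c ≠ 0)
    (h : ∀ p : Nat.Primes, D p ≤ D' p + padicValRat p c) {U : Opens SpecZBar} {q : ℚ}
    (hq : q ∈ finSections D U) : c * q ∈ finSections D' U :=
  ⟨fun p hp => by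
    have : Fact (p : ℕ).Prime := ⟨p.2⟩
    by_cases h0 : q = 0
    · exact Or.inl (by rw [h0, mul_zero])
    have h1 := (hq.1 p hp).resolve_left h0
    have h2 := h p
    refine Or.inr ?_
    rw [padicValRat.mul hc h0]
    omega, fun hU => by rw [hq.2 hU, mul_zero]⟩

theorem sumAbs_mul (c : ℚ) {n : GammaOp} (φ : Fin n.card → ℚ) :
    sumAbs (n := n) (fun i => c * φ i) = |(c : ℝ)| * sumAbs φ := by
  simp [sumAbs, abs_mul, Finset.mul_sum]

/-- The multiplication with `c`, as a morphism. -/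
noncomputable def scalarHom (hB : (0 : ℝ) ∈ B) (hB' : (0 : ℝ) ∈ B') {c : ℚ} (hc : c ≠ 0)
    (h : ∀ p : Nat.Primes, D p ≤ D' p + padicValRat p c)
    (hBB : ∀ t ∈ B, |(c : ℝ)| * t ∈ B') :
    normPresheaf D B hB ⟶ normPresheaf D' B' hB' where
  app U :=
    { app := fun k => ⟨fun x => (⟨fun i => c * NormSec.val x i,
          fun i => mul_mem_finSections hc h (NormSec.mem x i), fun hU => by
            rw [sumAbs_mul]; exact hBB _ (NormSec.bound x hU)⟩ : NormSec D' B' U k),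
        NormSec.ext (funext fun _ => mul_zero c)⟩
      naturality := fun m n f => by
        apply Pointed.Hom.ext
        funext x
        exact NormSec.ext (push_mul c f _).symm }
  app_res {U V} hUV := by
    apply NatTrans.ext
    funext k
    apply Pointed.Hom.ext
    funext x
    refine NormSec.ext (funext fun i => ?_)
    change unitSec U * (c * NormSec.val x i) = c * (unitSec U * NormSec.val x i)
    ring
  app_act U {m n k} v a x := by
    refine NormSec.ext (pair_ext fun F hF => ?_)
    change pair (fun i => c * prod (NormSec.val a) (NormSec.val x) v i) F =
      pair (prod (NormSec.val a) (fun i => c * NormSec.val x i) v) F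
    rw [pair_mul, prod_comm, prod_comm v, pair_prod _ _ _ _ hF, pair_prod _ _ _ _ hF, pair_mul]

/-- The multiplication with `c`, as an isomorphism. -/
noncomputable def scalarIso (hB : (0 : ℝ) ∈ B) (hB' : (0 : ℝ) ∈ B') {c : ℚ} (hc : c ≠ 0)
    (h : ∀ p : Nat.Primes, D p = D' p + padicValRat p c)
    (hBB : ∀ t, t ∈ B ↔ |(c : ℝ)| * t ∈ B') : normSheaf D B hB ≅ normSheaf D' B' hB' :=
  ObjectProperty.isoMk _
    { hom := scalarHom hB hB' hc (fun p => (h p).le) fun t => (hBB t).1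
      inv := scalarHom hB' hB (inv_ne_zero hc)
        (fun p => by
          have : Fact (p : ℕ).Prime := ⟨p.2⟩
          rw [padicValRat.inv, h p]
          omega)
        (fun t ht => by
          have hc' : |(c : ℝ)| ≠ 0 := by simpa using hc
          rwa [hBB, Rat.cast_inv, abs_inv, mul_inv_cancel_left₀ hc'])
      hom_inv_id := PresheafOfSMod.hom_ext_apply fun U n x =>
        NormSec.ext (funext fun i => inv_mul_cancel_left₀ hc (NormSec.val x i))
      inv_hom_id := PresheafOfSMod.hom_ext_apply fun U n x =>
        NormSec.ext (funext fun i => mul_inv_cancel_left₀ hc (NormSec.val x i)) }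

end Scalar

/-! ## Norm bounds -/

theorem exists_rat_split {l m : ℝ} (hm : 0 < m) {t : ℚ} (ht : 0 ≤ t)
    (h : (t : ℝ) < l * m) : ∃ r : ℚ, 0 < r ∧ (r : ℝ) < l ∧ ((t * r⁻¹ : ℚ) : ℝ) < m := by
  have ht' : (0 : ℝ) ≤ t := by exact_mod_cast ht
  obtain ⟨r, h1, h2⟩ := exists_rat_btwn ((div_lt_iff₀ hm).2 h)
  have hr : (0 : ℝ) < r := (div_nonneg ht' hm.le).trans_lt h1
  refine ⟨r, by exact_mod_cast hr, h2, ?_⟩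
  push_cast
  rw [← div_eq_mul_inv, div_lt_iff₀ hr, mul_comm]
  exact (div_lt_iff₀ hm).1 h1

theorem isProductBound_of_lt {B B' : LowerSet ℝ} {l m : ℝ} (hm : 0 < m)
    (hB : LowerSet.Iio l ≤ B) (hB' : LowerSet.Iio m ≤ B')
    (h : ∀ s t : ℚ, 0 ≤ s → 0 ≤ t → (s : ℝ) ∈ B → (t : ℝ) ∈ B' → (s : ℝ) * t < l * m) :
    IsProductBound B B' (LowerSet.Iio (l * m)) where
  mul s t hs ht hsB htB := by
    rw [LowerSet.mem_Iio_iff, Rat.cast_mul]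
    exact h s t hs ht hsB htB
  split t ht htB := by
    obtain ⟨r, h0, h1, h2⟩ := exists_rat_split hm ht (LowerSet.mem_Iio_iff.1 htB)
    exact ⟨r, h0, hB (LowerSet.mem_Iio_iff.2 h1), hB' (LowerSet.mem_Iio_iff.2 h2)⟩

theorem Iio_le_Iic (l : ℝ) : LowerSet.Iio l ≤ LowerSet.Iic l :=
  fun _ h => LowerSet.mem_Iic_iff.2 (LowerSet.mem_Iio_iff.1 h).le

theorem mul_lt_mul_of_lt_of_le_of_nonneg {s t l m : ℝ} (hs : 0 ≤ s) (hm : 0 < m) (h : s < l)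
    (h' : t ≤ m) : s * t < l * m :=
  (mul_le_mul_of_nonneg_left h' hs).trans_lt (mul_lt_mul_of_pos_right h hm)

theorem isProductBound_Iio_Iic {l m : ℝ} (hm : 0 < m) :
    IsProductBound (LowerSet.Iio l) (LowerSet.Iic m) (LowerSet.Iio (l * m)) :=
  isProductBound_of_lt hm le_rfl (Iio_le_Iic m) fun _ _ hs _ hsB htB =>
    mul_lt_mul_of_lt_of_le_of_nonneg (by exact_mod_cast hs) hm (LowerSet.mem_Iio_iff.1 hsB)
      (LowerSet.mem_Iic_iff.1 htB)

theorem isProductBound_Iic_Iio {l m : ℝ} (hl : 0 < l) (hm : 0 < m) :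
    IsProductBound (LowerSet.Iic l) (LowerSet.Iio m) (LowerSet.Iio (l * m)) :=
  isProductBound_of_lt hm (Iio_le_Iic l) le_rfl fun s t _ ht hsB htB => by
    rw [mul_comm (s : ℝ), mul_comm l]
    exact mul_lt_mul_of_lt_of_le_of_nonneg (by exact_mod_cast ht) hl (LowerSet.mem_Iio_iff.1 htB)
      (LowerSet.mem_Iic_iff.1 hsB)

theorem isProductBound_of_irrational {l m : ℝ} (hm : 0 < m) (hi : Irrational l) :
    IsProductBound (LowerSet.Iic l) (LowerSet.Iic m) (LowerSet.Iio (l * m)) :=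
  isProductBound_of_lt hm (Iio_le_Iic l) (Iio_le_Iic m) fun s _ hs _ hsB htB =>
    mul_lt_mul_of_lt_of_le_of_nonneg (by exact_mod_cast hs) hm
      (lt_of_le_of_ne (LowerSet.mem_Iic_iff.1 hsB) fun h => hi ⟨s, h⟩) (LowerSet.mem_Iic_iff.1 htB)

theorem isProductBound_Iic {l m : ℝ} (hl : 0 < l) (hm : 0 < m)
    (h : ¬ (Irrational l ∧ Irrational m ∧ ¬ Irrational (l * m))) :
    IsProductBound (LowerSet.Iic l) (LowerSet.Iic m) (LowerSet.Iic (l * m)) where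
  mul s t hs ht hsB htB := by
    rw [LowerSet.mem_Iic_iff, Rat.cast_mul]
    exact mul_le_mul (LowerSet.mem_Iic_iff.1 hsB) (LowerSet.mem_Iic_iff.1 htB)
      (by exact_mod_cast ht) hl.le
  split t ht htB := by
    rcases (LowerSet.mem_Iic_iff.1 htB).lt_or_eq with hlt | heq
    · obtain ⟨r, h0, h1, h2⟩ := exists_rat_split hm ht hlt
      exact ⟨r, h0, LowerSet.mem_Iic_iff.2 h1.le, LowerSet.mem_Iic_iff.2 h2.le⟩
    · have hl' : ¬ Irrational l := fun hi => h ⟨hi, by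
        rintro ⟨q, rfl⟩
        exact hi ⟨t / q, by rw [Rat.cast_div, heq, mul_div_cancel_right₀ _ hm.ne']⟩,
        fun hlm => hlm ⟨t, heq⟩⟩
      obtain ⟨r, rfl⟩ := not_not.1 hl'
      refine ⟨r, by exact_mod_cast hl, LowerSet.mem_Iic_iff.2 le_rfl, LowerSet.mem_Iic_iff.2 ?_⟩
      rw [Rat.cast_mul, heq, Rat.cast_inv, mul_comm (r : ℝ), mul_inv_cancel_right₀ hl.ne']

theorem isEmpty_iso_of_rat (D D' : FinDivisor) {ρ : ℚ} (hρ : 0 < ρ)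
    (h0 : (0 : ℝ) ∈ LowerSet.Iio (ρ : ℝ)) (h0' : (0 : ℝ) ∈ LowerSet.Iic (ρ : ℝ)) :
    IsEmpty (normSheaf D (LowerSet.Iio (ρ : ℝ)) h0 ≅ normSheaf D' (LowerSet.Iic (ρ : ℝ)) h0') :=
  ⟨fun e => by
    obtain ⟨c, hc0, -, hc⟩ := exists_scalar_of_iso e
    simp only [LowerSet.mem_Iio_iff, LowerSet.mem_Iic_iff, Rat.cast_lt, Rat.cast_le] at hc
    have hc' : 0 < |c| := abs_pos.2 hc0
    have h1 : ρ / |c| < ρ := by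
      have := mt (hc ρ hρ).2 (lt_irrefl ρ)
      rw [div_lt_iff₀ hc', mul_comm]
      exact not_le.1 this
    obtain ⟨r, hr1, hr2⟩ := exists_between h1
    have h2 := (hc r ((div_pos hρ hc').trans hr1)).1 hr2
    rw [div_lt_iff₀ hc', mul_comm] at hr1
    exact hr1.not_ge h2⟩

theorem eq_of_forall_rat_le_iff {l m : ℝ} (hl : 0 < l) (hm : 0 < m)
    (h : ∀ r : ℚ, 0 < r → ((r : ℝ) ≤ l ↔ (r : ℝ) ≤ m)) : l = m := by
  rcases lt_trichotomy l m with hlt | heq | hlt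
  · obtain ⟨r, h1, h2⟩ := exists_rat_btwn hlt
    exact absurd ((h r (by exact_mod_cast hl.trans h1)).2 h2.le) h1.not_ge
  · exact heq
  · obtain ⟨r, h1, h2⟩ := exists_rat_btwn hlt
    exact absurd ((h r (by exact_mod_cast hm.trans h1)).1 h2.le) h1.not_ge

theorem principallyEquivalent_iff {D D' : ArakelovDivisor} : PrincipallyEquivalent D D' ↔
    ∃ c : ℚ, c ≠ 0 ∧ (∀ p : Nat.Primes, D.1 p = D'.1 p + padicValRat p c) ∧
      |(c : ℝ)| * Real.exp D.2 = Real.exp D'.2 := by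
  have key : ∀ (c : ℚ) (hc : c ≠ 0), D' - D = principal (Units.mk0 c hc)⁻¹ ↔
      (∀ p : Nat.Primes, D.1 p = D'.1 p + padicValRat p c) ∧
        |(c : ℝ)| * Real.exp D.2 = Real.exp D'.2 := by
    intro c hc
    have hc' : (0 : ℝ) < |(c : ℝ)| := abs_pos.2 (by exact_mod_cast hc)
    rw [Prod.ext_iff]
    refine and_congr ?_ ?_
    · rw [DFunLike.ext_iff]
      refine forall_congr' fun p => ?_
      have : Fact (p : ℕ).Prime := ⟨p.2⟩
      change D'.1 p - D.1 p = padicValRat p (((Units.mk0 c hc)⁻¹ : ℚˣ) : ℚ) ↔ _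
      rw [Units.val_inv_eq_inv_val, Units.val_mk0, padicValRat.inv]
      omega
    · change D'.2 - D.2 = -Real.log |((((Units.mk0 c hc)⁻¹ : ℚˣ) : ℚ) : ℝ)| ↔ _
      rw [Units.val_inv_eq_inv_val, Units.val_mk0, Rat.cast_inv, abs_inv, Real.log_inv, neg_neg]
      nth_rw 2 [← Real.exp_log hc']
      rw [← Real.exp_add, Real.exp_eq_exp, sub_eq_iff_eq_add, eq_comm]
  constructor
  · rintro ⟨q, hq⟩
    refine ⟨(q⁻¹ : ℚˣ), Units.ne_zero _, (key _ (Units.ne_zero _)).1 ?_⟩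
    rw [hq, Units.mk0_val, inv_inv]
  · rintro ⟨c, hc, h⟩
    exact ⟨_, (key c hc).2 h⟩

theorem principallyEquivalent_iff_nonempty_iso (D D' : ArakelovDivisor) :
    PrincipallyEquivalent D D' ↔ Nonempty (sheafO D ≅ sheafO D') := by
  rw [principallyEquivalent_iff]
  constructor
  · rintro ⟨c, hc, h1, h2⟩
    have hc' : (0 : ℝ) < |(c : ℝ)| := abs_pos.2 (by exact_mod_cast hc)
    refine ⟨scalarIso _ _ hc h1 fun t => ?_⟩
    rw [LowerSet.mem_Iic_iff, LowerSet.mem_Iic_iff, ← h2, mul_le_mul_iff_right₀ hc']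
  · rintro ⟨e⟩
    obtain ⟨c, hc, h1, h2⟩ := exists_scalar_of_iso e
    have hc' : (0 : ℝ) < |(c : ℝ)| := abs_pos.2 (by exact_mod_cast hc)
    refine ⟨c, hc, h1, ?_⟩
    have : Real.exp D.2 = Real.exp D'.2 / |(c : ℝ)| :=
      eq_of_forall_rat_le_iff (Real.exp_pos _) (div_pos (Real.exp_pos _) hc') fun r hr => by
        have := h2 r hr
        rw [LowerSet.mem_Iic_iff, LowerSet.mem_Iic_iff] at this
        rw [this, le_div_iff₀ hc', Rat.cast_mul, Rat.cast_abs, mul_comm]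
    rw [this, mul_div_cancel₀ _ hc'.ne']

theorem zero_mem_Iio_exp (a : ℝ) : (0 : ℝ) ∈ LowerSet.Iio (Real.exp a) :=
  LowerSet.mem_Iio_iff.2 (Real.exp_pos a)

/-- The smash product of `O(D)` and `O(D')` in the exceptional case. -/
noncomputable def smashIsoOfExceptional (D D' : ArakelovDivisor) (h : Exceptional D D') :
    SheafOfSMod.smash (sheafO D) (sheafO D') ≅
      normSheaf (D + D').1 (LowerSet.Iio (Real.exp (D + D').2)) (zero_mem_Iio_exp _) :=
  smashIso _ _ _ rfl (by
    rw [Prod.snd_add, Real.exp_add]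
    exact isProductBound_of_irrational (Real.exp_pos _) h.1)

/-- The smash product of `O_ε` and `O(D)`. -/
noncomputable def smashEpsIso (D : ArakelovDivisor) : SheafOfSMod.smash sheafEps (sheafO D) ≅
    normSheaf D.1 (LowerSet.Iio (Real.exp D.2)) (zero_mem_Iio_exp _) :=
  smashIso _ _ _ (zero_add _).symm (by
    have := isProductBound_Iio_Iic (l := 1) (Real.exp_pos D.2)
    rwa [one_mul] at this)

/-- The smash product of `O(D)` and `O_ε`. -/
noncomputable def smashIsoEps (D : ArakelovDivisor) : SheafOfSMod.smash (sheafO D) sheafEps ≅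
    normSheaf D.1 (LowerSet.Iio (Real.exp D.2)) (zero_mem_Iio_exp _) :=
  smashIso _ _ _ (add_zero _).symm (by
    have := isProductBound_Iic_Iio (Real.exp_pos D.2) one_pos
    rwa [mul_one] at this)

theorem isEmpty_smash_iso (D D' : ArakelovDivisor) (h : Exceptional D D') :
    IsEmpty (SheafOfSMod.smash (sheafO D) (sheafO D') ≅ sheafO (D + D')) :=
  ⟨fun e => by
    obtain ⟨ρ, hρ⟩ := not_not.1 h.2.2
    rw [← Real.exp_add] at hρ
    have hρ0 : 0 < ρ := by
      have := hρ ▸ Real.exp_pos (D.2 + D'.2)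
      exact_mod_cast this
    have e' : normSheaf (D + D').1 (LowerSet.Iio (Real.exp (D.2 + D'.2))) (zero_mem_Iio_exp _) ≅
        normSheaf (D + D').1 (LowerSet.Iic (Real.exp (D.2 + D'.2))) (Real.exp_nonneg _) :=
      (smashIsoOfExceptional D D' h).symm ≪≫ e
    generalize_proofs h0 h0' at e'
    revert h0 h0'
    rw [← hρ]
    exact fun h0 h0' e' => (isEmpty_iso_of_rat _ _ hρ0 h0 h0').false e'⟩

end GammaArith

theorem mainTheorem4 :
    -- (i), the general case: the canonical morphism induced by the product is an isomorphism
    (∀ D D' : ArakelovDivisor, ¬ Exceptional D D' →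
      ∃ e : SheafOfSMod.smash (sheafO D) (sheafO D') ≅ sheafO (D + D'),
        ∀ (U : Opens SpecZBar) (m n k : GammaOp) (x : ((sheafO D).obj.obj U).obj m)
          (y : ((sheafO D').obj.obj U).obj n) (v : SmashMap m n k),
          evalAt (PresheafOfSMod.Hom.app e.hom.hom U) (SheafOfSMod.smashSec x y v) =
            mulSec x y v) ∧
    -- (i), the exceptional case
    (∀ D D' : ArakelovDivisor, Exceptional D D' →
      IsEmpty (SheafOfSMod.smash (sheafO D) (sheafO D') ≅ sheafO (D + D')) ∧
      Nonempty (SheafOfSMod.smash (sheafO D) (sheafO D') ≅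
        SheafOfSMod.smash sheafEps (sheafO (D + D'))) ∧
      Nonempty (SheafOfSMod.smash sheafEps (sheafO (D + D')) ≅
        SheafOfSMod.smash (sheafO (D + D')) sheafEps)) ∧
    -- (ii)
    (∀ D D' : ArakelovDivisor,
      PrincipallyEquivalent D D' ↔ Nonempty (sheafO D ≅ sheafO D')) := by
  refine ⟨fun D D' h => ?_, fun D D' h => ⟨isEmpty_smash_iso D D' h,
    ⟨smashIsoOfExceptional D D' h ≪≫ (smashEpsIso (D + D')).symm⟩,
    ⟨smashEpsIso (D + D') ≪≫ (smashIsoEps (D + D')).symm⟩⟩,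
    principallyEquivalent_iff_nonempty_iso⟩
  have hb : IsProductBound (LowerSet.Iic (Real.exp D.2)) (LowerSet.Iic (Real.exp D'.2))
      (LowerSet.Iic (Real.exp (D + D').2)) := by
    rw [Prod.snd_add, Real.exp_add]
    exact isProductBound_Iic (Real.exp_pos _) (Real.exp_pos _) h
  exact ⟨smashIso _ _ _ rfl hb, fun U m n k x y v =>
    smashIso_smashSec _ _ _ rfl hb x y v⟩
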